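/- Let $p\ge 1$ and $0<\alpha<2$, let $|\cdot|$ be the Euclidean norm on $\mathbb{R}^p$, and let $X,Y$ be $\mathbb{R}^p$-valued random vectors on a common probability space with $E|X|^\alpha+E|Y|^\alpha<\infty$. Put $$\phi_{X,Y}(s,t)=E\,e^{i\langle s,X\rangle+i\langle t,Y\rangle},\qquad \phi_X(t)=\phi_{X,Y}(t,0),\qquad \phi_Y(t)=\phi_{X,Y}(0,t),$$ $$siCov^{(\alpha)}(X,Y)=\frac1{c(p,\alpha)}\int_{\mathbb{R}^p}\frac{|\phi_{X,Y}(t,t)-\phi_X(t)\phi_Y(t)|^2}{|t|^{\alpha+p}}\,dt,\qquad c(p,\alpha)=\frac{2\pi^{p/2}\,\Gamma(1-\alpha/2)}{\alpha\,2^{\alpha}\,\Gamma((\alpha+p)/2)}.$$ For $z_a=(x_a,y_a)\in\mathbb{R}^p\times\mathbb{R}^p$, $a=1,\dots,4$, define the symmetric kernel $$k(z_1,z_2,z_3,z_4)=\frac1{12}\sum_{i,j,k}|x_i+y_i-x_j-y_k|^\alpha-\frac1{24}\sum_{i,j,k,l}|x_i+y_j-x_k-y_l|^\alpha-\frac1{12}\sum_{i,j}|x_i+y_i-x_j-y_j|^\alpha,$$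 where each sum runs over all tuples of pairwise distinct indices in $\{1,2,3,4\}$, and its first projection $$k_1(z)=E\,k(z,Z_2,Z_3,Z_4),\qquad Z_2,Z_3,Z_4\ \text{independent copies of}\ (X,Y).$$ Let $(X_1,Y_1),(X_2,Y_2),\dots$ be independent copies of $(X,Y)$ and let $$\widehat{siCov^{(\alpha)}}_n(X,Y)=\binom n4^{-1}\sum_{1\le i<j<k<l\le n}k\big((X_i,Y_i),(X_j,Y_j),(X_k,Y_k),(X_l,Y_l)\big).$$ **Theorem 5.2.** If $0<\mathrm{Var}(k_1(X,Y))<\infty$, then, as $n\to\infty$, $$\sqrt n\,\Big(\widehat{siCov^{(\alpha)}}_n(X,Y)-siCov^{(\alpha)}(X,Y)\Big)\ \xrightarrow{\ \mathcal D\ }\ N\big(0,\;16\,\mathrm{Var}(k_1(X,Y))\big).$$ -/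

import Mathlib

open MeasureTheory ProbabilityTheory Filter
open scoped RealInnerProductSpace

noncomputable section

namespace SubIndep

/-- The Euclidean space `ℝᵖ`, with the Euclidean norm. -/
abbrev E (p : ℕ) : Type := EuclideanSpace ℝ (Fin p)

/-- The constant `c(p, α) = 2 π^(p/2) Γ(1 - α/2) / (α 2^α Γ((α + p)/2))`. -/
def c (p : ℕ) (α : ℝ) : ℝ :=
  2 * Real.pi ^ ((p : ℝ) / 2) * Real.Gamma (1 - α / 2) /
    (α * (2 : ℝ) ^ α * Real.Gamma ((α + p) / 2))

/-- The weight `ρ_α(t) = c(p, α)⁻¹ |t|^(-α-p)`. -/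
def rho {p : ℕ} (α : ℝ) (t : E p) : ℝ := (c p α)⁻¹ * ‖t‖ ^ (-α - p)

section Covariance

variable {p : ℕ} {Ω : Type*} [MeasurableSpace Ω]

/-- The joint characteristic function `φ_{X,Y}(s, t) = E exp(i⟨s, X⟩ + i⟨t, Y⟩)`. -/
def jointCF (P : Measure Ω) (X Y : Ω → E p) (s t : E p) : ℂ :=
  ∫ ω, Complex.exp (Complex.I * (⟪s, X ω⟫ : ℝ) + Complex.I * (⟪t, Y ω⟫ : ℝ)) ∂P

/-- The `α`-sub-independent covariance of `X` and `Y`, the integral of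
`|φ_{X,Y}(t, t) - φ_X(t) φ_Y(t)|² ρ_α(t)` over `ℝᵖ`, where
`φ_X(t) = φ_{X,Y}(t, 0)` and `φ_Y(t) = φ_{X,Y}(0, t)`. -/
def siCov (P : Measure Ω) (α : ℝ) (X Y : Ω → E p) : ℝ :=
  ∫ t : E p, ‖jointCF P X Y t t - jointCF P X Y t 0 * jointCF P X Y 0 t‖ ^ 2 * rho α t

end Covariance

section Estimator

variable {p : ℕ}

/-- The symmetric kernel of order four at the points `z a = (x_a, y_a)`.
The sums run over all tuples of pairwise distinct indices. -/
def kernel (α : ℝ) (z : Fin 4 → E p × E p) : ℝ :=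
  (1 / 12) * ∑ s : Fin 3 ↪ Fin 4,
      ‖(z (s 0)).1 + (z (s 0)).2 - (z (s 1)).1 - (z (s 2)).2‖ ^ α
  - (1 / 24) * ∑ s : Fin 4 ↪ Fin 4,
      ‖(z (s 0)).1 + (z (s 1)).2 - (z (s 2)).1 - (z (s 3)).2‖ ^ α
  - (1 / 12) * ∑ s : Fin 2 ↪ Fin 4,
      ‖(z (s 0)).1 + (z (s 0)).2 - (z (s 1)).1 - (z (s 1)).2‖ ^ α

open Classical in
/-- The U-statistic with kernel `kernel α` on the sample points `w 0, …, w (n - 1)`: the sum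
over all index tuples `i < j < k < l`, divided by the binomial coefficient `n` over `4`. -/
def siCovEst (α : ℝ) (n : ℕ) (w : ℕ → E p × E p) : ℝ :=
  ((n.choose 4 : ℕ) : ℝ)⁻¹ *
    ∑ q : Fin 4 → Fin n with StrictMono q, kernel α (fun a => w (q a))

/-- The first projection of the kernel, `k₁(z) = E k(z, Z₂, Z₃, Z₄)`, where `Z₂, Z₃, Z₄` are
independent with law `ν`. -/
def kOne (α : ℝ) (ν : Measure (E p × E p)) (z : E p × E p) : ℝ :=
  ∫ w : (E p × E p) × (E p × E p) × (E p × E p),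
    kernel α ![z, w.1, w.2.1, w.2.2] ∂(ν.prod (ν.prod ν))

end Estimator

end SubIndep

end

/-! The estimator is a U-statistic of order four, so the result is Hoeffding's central limit theorem
(`tendstoInDistribution_uStat`), once the kernel is known to be square integrable with mean `siCov`.

Hoeffding's theorem: subtract from the kernel its mean and the sum of its centred first projections.
The U-statistic then equals its mean, plus a normalised sum of i.i.d. variables to which the
classical theorem applies, plus a U-statistic with a degenerate kernel. For a degenerate kernel,
terms sharing at most one sample point are orthogonal, so the second moment of that last part is
O(n⁻²) and multiplication by √n does not save it from vanishing.

Square integrability is the delicate point: the kernel is built from α-th powers of norms, which are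
only assumed integrable, so it has to come from cancellation. The identity ‖x‖^α = ∫ (1 - cos⟪t, x⟫)
ρ_α(t) dt (`integral_one_sub_cos_mul_rho`) turns the kernel into a ρ_α-integral of an algebraic
expression in u_a = exp(i⟪t, x_a⟫) and v_a = exp(i⟪t, y_a⟫). By `kernelComb_one_sub_re` this
expression is a sum over the three splittings of four points into two pairs, each term containing a
product of increments over both pairs. Bounding the increments of v by 2 and applying Cauchy–Schwarz
in L²(ρ_α) bounds the kernel by terms √(‖x_i - x_j‖^α ‖x_k - x_l‖^α) (`abs_kernel_le`). The square
of such a term is a product of independent integrable variables. The same representation, with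
Fubini and independence of disjoint pairs, gives the mean (`integral_kernel`). -/

noncomputable section

namespace SubIndep

/-! ### First projections and orthogonality for degenerate kernels. -/

section UStatistic

variable {S Ω : Type*} [MeasurableSpace S] [MeasurableSpace Ω]

/-- The first projection of a symmetric kernel of order `m + 1` with respect to the law `ν`. -/
def firstProj {m : ℕ} (ν : Measure S) (k : (Fin (m + 1) → S) → ℝ) (z : S) : ℝ :=
  ∫ w, k (Fin.cons z w) ∂(Measure.pi fun _ : Fin m => ν)

lemma measurable_finCons {m : ℕ} :
    Measurable (fun v : S × (Fin m → S) => (Fin.cons v.1 v.2 : Fin (m + 1) → S)) := by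
  refine measurable_pi_iff.2 fun a => ?_
  refine Fin.cases ?_ (fun b => ?_) a
  · simpa using measurable_fst
  · simp only [Fin.cons_succ]
    fun_prop

lemma measurePreserving_finCons {m : ℕ} (ν : Measure S) [SigmaFinite ν] :
    MeasurePreserving (fun v : S × (Fin m → S) => (Fin.cons v.1 v.2 : Fin (m + 1) → S))
      (ν.prod (Measure.pi fun _ : Fin m => ν)) (Measure.pi fun _ : Fin (m + 1) => ν) := by
  have h := (measurePreserving_piFinSuccAbove (fun _ : Fin (m + 1) => ν) 0).symm
  convert! h using 1
  funext v
  exact (Fin.insertNth_zero' v.1 v.2).symm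

lemma measurable_firstProj {m : ℕ} {ν : Measure S} [IsProbabilityMeasure ν]
    {k : (Fin (m + 1) → S) → ℝ} (hk : Measurable k) : Measurable (firstProj ν k) := by
  have : StronglyMeasurable (Function.uncurry fun (z : S) (w : Fin m → S) =>
      k (Fin.cons z w : Fin (m + 1) → S)) :=
    (hk.comp measurable_finCons).stronglyMeasurable
  exact this.integral_prod_right.measurable

lemma integral_firstProj {m : ℕ} {ν : Measure S} [IsProbabilityMeasure ν]
    {k : (Fin (m + 1) → S) → ℝ} (hk : Measurable k)
    (hi : Integrable k (Measure.pi fun _ : Fin (m + 1) => ν)) :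
    ∫ z, firstProj ν k z ∂ν = ∫ z, k z ∂(Measure.pi fun _ : Fin (m + 1) => ν) := by
  have hp := measurePreserving_finCons (m := m) ν
  rw [← hp.map_eq, integral_map hp.measurable.aemeasurable hk.aestronglyMeasurable,
    integral_prod (fun v : S × (Fin m → S) => k (Fin.cons v.1 v.2))
      (hp.integrable_comp_of_integrable hi)]
  rfl

variable {ν : Measure S} {P : Measure Ω} {Z : ℕ → Ω → S}

lemma map_comp_injective {m : ℕ} (hZ : ∀ i, AEMeasurable (Z i) P) (hlaw : ∀ i, P.map (Z i) = ν)
    (hind : iIndepFun Z P) {q : Fin m → ℕ} (hq : Function.Injective q) :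
    P.map (fun ω a => Z (q a) ω) = Measure.pi fun _ : Fin m => ν := by
  have := iIndepFun.map_fun_eq_pi_map (f := fun a => Z (q a)) (fun a => hZ _) (hind.precomp hq)
  simpa only [hlaw] using this

lemma aemeasurable_comp {m : ℕ} (hZ : ∀ i, AEMeasurable (Z i) P) (q : Fin m → ℕ) :
    AEMeasurable (fun ω a => Z (q a) ω) P :=
  aemeasurable_pi_iff.2 fun _ => hZ _

lemma memLp_comp_injective {m : ℕ} (hZ : ∀ i, AEMeasurable (Z i) P)
    (hlaw : ∀ i, P.map (Z i) = ν) (hind : iIndepFun Z P) {q : Fin m → ℕ}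
    (hq : Function.Injective q) {h : (Fin m → S) → ℝ}
    (hL : MemLp h 2 (Measure.pi fun _ => ν)) :
    MemLp (fun ω => h (fun a => Z (q a) ω)) 2 P := by
  rw [← map_comp_injective hZ hlaw hind hq] at hL
  exact (memLp_map_measure_iff hL.1 (aemeasurable_comp hZ q)).1 hL

lemma integral_sq_comp_injective {m : ℕ} (hZ : ∀ i, AEMeasurable (Z i) P)
    (hlaw : ∀ i, P.map (Z i) = ν) (hind : iIndepFun Z P) {q : Fin m → ℕ}
    (hq : Function.Injective q) {h : (Fin m → S) → ℝ} (hm : Measurable h) :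
    ∫ ω, h (fun a => Z (q a) ω) ^ 2 ∂P = ∫ z, h z ^ 2 ∂(Measure.pi fun _ => ν) := by
  rw [← map_comp_injective hZ hlaw hind hq,
    integral_map (aemeasurable_comp hZ q) (hm.pow_const 2).aestronglyMeasurable]

/-- Two evaluations of a degenerate kernel on an independent sequence are orthogonal if the first
shares at most the sample point in its zeroth argument with the second. -/
lemma integral_mul_eq_zero_of_degenerate [IsProbabilityMeasure P] {m : ℕ}
    (hZ : ∀ i, AEMeasurable (Z i) P) (hlaw : ∀ i, P.map (Z i) = ν) (hind : iIndepFun Z P)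
    {h : (Fin (m + 1) → S) → ℝ} (hm : Measurable h)
    (hL : MemLp h 2 (Measure.pi fun _ => ν)) (hdeg : ∀ᵐ z ∂ν, firstProj ν h z = 0)
    {q q' : Fin (m + 1) → ℕ} (hq : Function.Injective q) (hq' : Function.Injective q')
    (hdisj : ∀ a, a ≠ 0 → ∀ b, q a ≠ q' b) :
    ∫ ω, h (fun a => Z (q a) ω) * h (fun a => Z (q' a) ω) ∂P = 0 := by
  classical
  have : IsProbabilityMeasure ν := by
    rw [← hlaw 0]; exact Measure.isProbabilityMeasure_map (hZ 0)
  -- Given the sample points with index in B, those with index in A are still i.i.d. with law ν.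
  -- Integrating them out of the first factor leaves its first projection at `Z (q 0)`, which
  -- vanishes almost surely. The index `q 0` is put into B explicitly because it need not occur in
  -- `q'`.
  let A : Finset ℕ := Finset.univ.image fun a : Fin m => q a.succ
  let B : Finset ℕ := insert (q 0) (Finset.univ.image q')
  have hAB : Disjoint B A := by
    rw [Finset.disjoint_right]
    intro x hx hxB
    simp only [A, B, Finset.mem_image, Finset.mem_univ, true_and, Finset.mem_insert] at hx hxB
    obtain ⟨a, rfl⟩ := hx
    rcases hxB with hxB | ⟨b, hb⟩
    · exact Fin.succ_ne_zero a (hq hxB)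
    · exact hdisj a.succ (Fin.succ_ne_zero a) b hb.symm
  have hI := iIndepFun.indepFun_finset₀ B A hAB hind hZ
  let V : Ω → S × (Fin (m + 1) → S) := fun ω => (Z (q 0) ω, fun b => Z (q' b) ω)
  let W : Ω → (Fin m → S) := fun ω a => Z (q a.succ) ω
  have hVW : IndepFun V W P := by
    have hf : Measurable fun x : (B → S) =>
        ((x ⟨q 0, by simp [B]⟩, fun b => x ⟨q' b, by simp [B]⟩) : S × (Fin (m + 1) → S)) := by
      fun_prop
    have hg : Measurable fun x : (A → S) => ((fun a => x ⟨q a.succ, by simp [A]⟩) : Fin m → S) := by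
      fun_prop
    exact hI.comp hf hg
  have hVm : AEMeasurable V P := (hZ _).prodMk (aemeasurable_comp hZ q')
  have hWm : AEMeasurable W P := aemeasurable_comp hZ fun a => q a.succ
  have hlawVW := (indepFun_iff_map_prod_eq_prod_map_map hVm hWm).1 hVW
  have hlawW : P.map W = Measure.pi fun _ : Fin m => ν :=
    map_comp_injective hZ hlaw hind (hq.comp (Fin.succ_injective m))
  let F : (S × (Fin (m + 1) → S)) × (Fin m → S) → ℝ := fun x =>
    h (Fin.cons x.1.1 x.2) * h x.1.2
  have hF : Measurable F := by
    have h1 : Measurable fun x : (S × (Fin (m + 1) → S)) × (Fin m → S) =>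
        h (Fin.cons x.1.1 x.2) :=
      hm.comp (measurable_finCons.comp
        ((measurable_fst.comp measurable_fst).prodMk measurable_snd))
    have h2 : Measurable fun x : (S × (Fin (m + 1) → S)) × (Fin m → S) => h x.1.2 :=
      hm.comp (measurable_snd.comp measurable_fst)
    exact h1.mul h2
  have hFeq : (fun ω => h (fun a => Z (q a) ω) * h (fun a => Z (q' a) ω)) =
      fun ω => F (V ω, W ω) := by
    funext ω
    have : (fun a => Z (q a) ω) = (Fin.cons (V ω).1 (W ω) : Fin (m + 1) → S) := by
      funext a
      refine Fin.cases ?_ (fun b => ?_) a <;> simp [V, W]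
    simp only [F, this]
    rfl
  have hint : Integrable (fun ω => F (V ω, W ω)) P := by
    rw [← hFeq]
    exact (memLp_comp_injective hZ hlaw hind hq hL).integrable_mul
      (memLp_comp_injective hZ hlaw hind hq' hL)
  have hint' : Integrable F ((P.map V).prod (P.map W)) := by
    rw [← hlawVW]
    exact (integrable_map_measure hF.aestronglyMeasurable (hVm.prodMk hWm)).2 hint
  rw [hFeq, ← integral_map (hVm.prodMk hWm) hF.aestronglyMeasurable, hlawVW,
    integral_prod _ hint', hlawW]
  have hdeg' : ∀ᵐ v ∂(P.map V), firstProj ν h v.1 = 0 := by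
    have h1 : (P.map V).map Prod.fst = ν := by
      rw [AEMeasurable.map_map_of_aemeasurable measurable_fst.aemeasurable hVm]
      exact hlaw (q 0)
    have h2 : ∀ᵐ z ∂((P.map V).map Prod.fst), firstProj ν h z = 0 := by rwa [h1]
    exact ae_of_ae_map measurable_fst.aemeasurable h2
  refine integral_eq_zero_of_ae ?_
  filter_upwards [hdeg'] with v hv
  simp only [F]
  rw [integral_mul_const]
  simp only [firstProj] at hv
  rw [hv, zero_mul]; rfl

end UStatistic

/-! ### Counting index tuples. -/

section Counting

open Classical in
/-- The strictly increasing index tuples. -/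
def incTuples (m n : ℕ) : Finset (Fin m → Fin n) := {q | StrictMono q}

lemma mem_incTuples {m n : ℕ} {q : Fin m → Fin n} : q ∈ incTuples m n ↔ StrictMono q := by
  simp [incTuples]

/-- A strictly increasing tuple is the increasing enumeration of its image, so such tuples
correspond to subsets of size `m`, for which binomial counts are available. -/
lemma sum_incTuples {m n : ℕ} (F : Finset (Fin n) → ℝ) :
    ∑ q ∈ incTuples m n, F (Finset.univ.image q) =
      ∑ s ∈ Finset.powersetCard m (Finset.univ : Finset (Fin n)), F s := by
  refine Finset.sum_bij (fun q _ => Finset.univ.image q) ?_ ?_ ?_ ?_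
  · intro q hq
    rw [mem_incTuples] at hq
    simp [Finset.mem_powersetCard, Finset.card_image_of_injective _ hq.injective]
  · intro q hq q' hq' h
    rw [mem_incTuples] at hq hq'
    have hc : (Finset.univ.image q).card = m := by
      simp [Finset.card_image_of_injective _ hq.injective]
    rw [Finset.orderEmbOfFin_unique hc (f := q) (by simp) hq,
      Finset.orderEmbOfFin_unique hc (f := q') (by rw [h]; simp) hq']
  · intro s hs
    have hc := (Finset.mem_powersetCard.1 hs).2
    refine ⟨s.orderEmbOfFin hc, mem_incTuples.2 (s.orderEmbOfFin hc).strictMono, ?_⟩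
    simp
  · intro q hq
    rfl

lemma card_incTuples (m n : ℕ) : ((incTuples m n).card : ℝ) = n.choose m := by
  have := sum_incTuples (m := m) (n := n) fun _ => 1
  simpa using this

/-- A given index lies in `n.choose m` of the subsets of size `m + 1`, since removing it leaves an
arbitrary subset of size `m` of the other `n` indices. This yields the coefficient of the linear
part of a U-statistic. -/
lemma sum_incTuples_sum (m n : ℕ) (f : Fin (n + 1) → ℝ) :
    ∑ q ∈ incTuples (m + 1) (n + 1), ∑ a, f (q a) = (n.choose m : ℝ) * ∑ i, f i := by
  have h1 : ∑ q ∈ incTuples (m + 1) (n + 1), ∑ a, f (q a) =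
      ∑ q ∈ incTuples (m + 1) (n + 1), ∑ i ∈ Finset.univ.image q, f i := by
    refine Finset.sum_congr rfl fun q hq => ?_
    rw [Finset.sum_image (mem_incTuples.1 hq).injective.injOn]
  rw [h1, sum_incTuples (fun s => ∑ i ∈ s, f i)]
  have h2 : ∀ s : Finset (Fin (n + 1)), ∑ i ∈ s, f i = ∑ i, if i ∈ s then f i else 0 := by
    intro s
    simp
  simp_rw [h2]
  rw [Finset.sum_comm, Finset.mul_sum]
  refine Finset.sum_congr rfl fun i _ => ?_
  rw [← Finset.sum_filter, Finset.sum_const, nsmul_eq_mul]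
  simp only [Finset.mem_univ, if_true]
  congr 2
  have h3 : (Finset.powersetCard (m + 1) (Finset.univ : Finset (Fin (n + 1)))).filter (i ∈ ·) =
      (Finset.powersetCard m (Finset.univ.erase i)).image (insert i) := by
    ext s
    simp only [Finset.mem_filter, Finset.mem_powersetCard, Finset.subset_univ, true_and,
      Finset.mem_image]
    constructor
    · rintro ⟨hc, hi⟩
      refine ⟨s.erase i, ⟨Finset.erase_subset_erase _ (Finset.subset_univ _), ?_⟩,
        Finset.insert_erase hi⟩
      rw [Finset.card_erase_of_mem hi, hc]; rfl
    · rintro ⟨t, ⟨ht, hc⟩, rfl⟩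
      have : i ∉ t := fun h => by simpa using ht h
      exact ⟨by rw [Finset.card_insert_of_notMem this, hc], Finset.mem_insert_self _ _⟩
  rw [h3, Finset.card_image_of_injOn, Finset.card_powersetCard]
  · simp
  · intro t ht t' ht' h
    have hn : ∀ u ∈ (Finset.powersetCard m (Finset.univ.erase i) : Finset (Finset (Fin (n + 1)))),
        i ∉ u := fun u hu h => by simpa using (Finset.mem_powersetCard.1 hu).1 h
    have := congrArg (Finset.erase · i) h
    simpa [Finset.erase_insert (hn t ht), Finset.erase_insert (hn t' ht')] using this

/-- The number of index tuples with two prescribed coordinates. -/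
lemma card_tuples_two_fixed {m n : ℕ} {a b : Fin (m + 2)} (hab : a ≠ b) (i j : Fin n) :
    (Finset.univ.filter fun q : Fin (m + 2) → Fin n => q a = i ∧ q b = j).card = n ^ m := by
  have h : (Finset.univ.filter fun q : Fin (m + 2) → Fin n => q a = i ∧ q b = j) =
      Fintype.piFinset fun c => if c = a then {i} else if c = b then {j} else Finset.univ := by
    ext q
    simp only [Finset.mem_filter, Finset.mem_univ, true_and, Fintype.mem_piFinset]
    constructor
    · rintro ⟨rfl, rfl⟩ c
      split_ifs with h1 h2 <;> simp_all
    · intro h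
      have h1 := h a
      have h2 := h b
      simp only [if_true, if_neg hab.symm, Finset.mem_singleton] at h1 h2
      exact ⟨h1, h2⟩
  rw [h, Fintype.card_piFinset]
  have h2 : ∀ c : Fin (m + 2), (if c = a then ({i} : Finset (Fin n)) else
      if c = b then {j} else Finset.univ).card = if c ∈ ({a, b} : Finset (Fin (m + 2))) then 1 else n := by
    intro c
    simp only [Finset.mem_insert, Finset.mem_singleton]
    split_ifs <;> simp_all
  simp_rw [h2]
  rw [Finset.prod_ite]
  simp only [Finset.prod_const_one, one_mul, Finset.prod_const]
  congr 1
  rw [Finset.filter_not, Finset.card_sdiff_of_subset (by simp)]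
  rw [Finset.filter_mem_eq_inter, Finset.univ_inter, Finset.card_pair hab]
  simp

/-- The number of index tuples meeting a given injective tuple in at least two places. -/
lemma card_tuples_two_common {m n : ℕ} {q : Fin (m + 2) → Fin n} (hq : Function.Injective q) :
    (Finset.univ.filter fun q' : Fin (m + 2) → Fin n =>
      ∃ a b, a ≠ b ∧ (∃ c, q a = q' c) ∧ ∃ d, q b = q' d).card ≤ (m + 2) ^ 4 * n ^ m := by
  classical
  -- A quadruple (a, b, c, d) records which positions of `q` and `q'` match. Each quadruple with c ≠
  -- d prescribes two coordinates of `q'`; the case c = d cannot occur because `q` is injective.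
  let T := (Finset.univ : Finset (Fin (m + 2) × Fin (m + 2) × Fin (m + 2) × Fin (m + 2)))
  have hsub : (Finset.univ.filter fun q' : Fin (m + 2) → Fin n =>
      ∃ a b, a ≠ b ∧ (∃ c, q a = q' c) ∧ ∃ d, q b = q' d) ⊆
      T.biUnion fun t => if t.2.2.1 = t.2.2.2 then ∅ else
        Finset.univ.filter fun q' : Fin (m + 2) → Fin n => q' t.2.2.1 = q t.1 ∧ q' t.2.2.2 = q t.2.1 := by
    intro q' h
    simp only [Finset.mem_filter, Finset.mem_univ, true_and] at h
    obtain ⟨a, b, hab, ⟨c, hc⟩, d, hd⟩ := h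
    have hcd : c ≠ d := by
      rintro rfl
      exact hab (hq (hc.trans hd.symm))
    refine Finset.mem_biUnion.2 ⟨(a, b, c, d), Finset.mem_univ _, ?_⟩
    simp [hcd, hc, hd]
  refine (Finset.card_le_card hsub).trans (Finset.card_biUnion_le.trans ?_)
  refine (Finset.sum_le_card_nsmul _ _ (n ^ m) fun t _ => ?_).trans ?_
  · split_ifs with h
    · simp
    · exact (card_tuples_two_fixed h _ _).le
  · simp only [T, Finset.card_univ, Fintype.card_prod, Fintype.card_fin, smul_eq_mul]
    exact le_of_eq (by ring)

end Counting

/-! ### Second moments of sums with a degenerate kernel. -/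

section DegenerateSums

variable {S Ω : Type*} [MeasurableSpace S] [MeasurableSpace Ω]
  {ν : Measure S} {P : Measure Ω} {Z : ℕ → Ω → S}

/-- Two evaluations of a symmetric degenerate kernel on an independent sequence are orthogonal
if they share at most one sample point. -/
lemma integral_mul_eq_zero_of_common_le_one [IsProbabilityMeasure P] {m : ℕ}
    (hZ : ∀ i, AEMeasurable (Z i) P) (hlaw : ∀ i, P.map (Z i) = ν) (hind : iIndepFun Z P)
    {h : (Fin (m + 1) → S) → ℝ} (hm : Measurable h)
    (hsymm : ∀ (σ : Equiv.Perm (Fin (m + 1))) z, h (z ∘ σ) = h z)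
    (hL : MemLp h 2 (Measure.pi fun _ => ν)) (hdeg : ∀ᵐ z ∂ν, firstProj ν h z = 0)
    {q q' : Fin (m + 1) → ℕ} (hq : Function.Injective q) (hq' : Function.Injective q')
    (hcommon : ¬ ∃ a b, a ≠ b ∧ (∃ c, q a = q' c) ∧ ∃ d, q b = q' d) :
    ∫ ω, h (fun a => Z (q a) ω) * h (fun a => Z (q' a) ω) ∂P = 0 := by
  -- The position in `q` of the common point, or an arbitrary position if there is none; by symmetry
  -- of the kernel it can be swapped into place zero.
  obtain ⟨a₀, ha₀⟩ : ∃ a₀, ∀ a, a ≠ a₀ → ∀ b, q a ≠ q' b := by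
    by_cases hex : ∃ a c, q a = q' c
    · obtain ⟨a, c, hac⟩ := hex
      exact ⟨a, fun b hb d hd => hcommon ⟨a, b, hb.symm, ⟨c, hac⟩, d, hd⟩⟩
    · push Not at hex
      exact ⟨0, fun a _ => hex a⟩
  let σ : Equiv.Perm (Fin (m + 1)) := Equiv.swap 0 a₀
  have key := integral_mul_eq_zero_of_degenerate hZ hlaw hind hm hL hdeg
    (q := q ∘ σ) (q' := q') (hq.comp σ.injective) hq' (fun a ha b => by
      refine ha₀ (σ a) (fun hσ => ha ?_) b
      have : σ a = σ 0 := by rw [hσ]; simp [σ]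
      exact σ.injective this)
  rw [← key]
  refine integral_congr_ae (Eventually.of_forall fun ω => ?_)
  simp only
  rw [← hsymm σ fun a => Z (q a) ω]
  rfl

/-- In the expanded square only pairs of tuples sharing at least two indices contribute, each at
most the second moment of `h` by 2xy ≤ x² + y². There are at most n^(m+2) choices of the first tuple
and then (m+2)^4 n^m of the second, which is two powers of n below the number of all pairs. -/
lemma integral_sum_sq_le [IsProbabilityMeasure P] {m : ℕ}
    (hZ : ∀ i, AEMeasurable (Z i) P) (hlaw : ∀ i, P.map (Z i) = ν) (hind : iIndepFun Z P)
    {h : (Fin (m + 2) → S) → ℝ} (hm : Measurable h)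
    (hsymm : ∀ (σ : Equiv.Perm (Fin (m + 2))) z, h (z ∘ σ) = h z)
    (hL : MemLp h 2 (Measure.pi fun _ => ν)) (hdeg : ∀ᵐ z ∂ν, firstProj ν h z = 0) (n : ℕ) :
    ∫ ω, (∑ q ∈ incTuples (m + 2) n, h (fun a => Z (q a) ω)) ^ 2 ∂P ≤
      ((m + 2) ^ 4 * n ^ (2 * m + 2) : ℕ) * ∫ z, h z ^ 2 ∂(Measure.pi fun _ => ν) := by
  classical
  set C : ℝ := ∫ z, h z ^ 2 ∂(Measure.pi fun _ => ν) with hC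
  have hinj : ∀ q ∈ incTuples (m + 2) n, Function.Injective fun a => ((q a : Fin n) : ℕ) :=
    fun q hq => Fin.val_injective.comp (mem_incTuples.1 hq).injective
  have hLq : ∀ q ∈ incTuples (m + 2) n, MemLp (fun ω => h (fun a => Z (q a) ω)) 2 P :=
    fun q hq => memLp_comp_injective hZ hlaw hind (hinj q hq) hL
  have hSq : ∀ q ∈ incTuples (m + 2) n, ∫ ω, h (fun a => Z (q a) ω) ^ 2 ∂P = C :=
    fun q hq => integral_sq_comp_injective hZ hlaw hind (hinj q hq) hm
  have hC0 : 0 ≤ C := integral_nonneg fun z => sq_nonneg _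
  have hle : ∀ q ∈ incTuples (m + 2) n, ∀ q' ∈ incTuples (m + 2) n,
      ∫ ω, h (fun a => Z (q a) ω) * h (fun a => Z (q' a) ω) ∂P ≤
        if ∃ a b, a ≠ b ∧ (∃ c, q a = q' c) ∧ ∃ d, q b = q' d then C else 0 := by
    intro q hq q' hq'
    split_ifs with hcom
    · calc ∫ ω, h (fun a => Z (q a) ω) * h (fun a => Z (q' a) ω) ∂P
          ≤ ∫ ω, (1 / 2 * h (fun a => Z (q a) ω) ^ 2 + 1 / 2 * h (fun a => Z (q' a) ω) ^ 2) ∂P := by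
            refine integral_mono ((hLq q hq).integrable_mul (hLq q' hq'))
              (((hLq q hq).integrable_sq.const_mul _).add ((hLq q' hq').integrable_sq.const_mul _))
              fun ω => ?_
            simp only
            nlinarith [sq_nonneg (h (fun a => Z (q a) ω) - h (fun a => Z (q' a) ω))]
        _ = C := by
            rw [integral_add ((hLq q hq).integrable_sq.const_mul _)
              ((hLq q' hq').integrable_sq.const_mul _), integral_const_mul, integral_const_mul,
              hSq q hq, hSq q' hq']
            ring
    · refine (integral_mul_eq_zero_of_common_le_one hZ hlaw hind hm hsymm hL hdeg
        (hinj q hq) (hinj q' hq') ?_).le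
      rintro ⟨a, b, hab, ⟨c, hc⟩, d, hd⟩
      exact hcom ⟨a, b, hab, ⟨c, Fin.val_injective hc⟩, d, Fin.val_injective hd⟩
  have hexp : ∀ ω, (∑ q ∈ incTuples (m + 2) n, h (fun a => Z (q a) ω)) ^ 2 =
      ∑ q ∈ incTuples (m + 2) n, ∑ q' ∈ incTuples (m + 2) n,
        h (fun a => Z (q a) ω) * h (fun a => Z (q' a) ω) := by
    intro ω
    rw [sq, Finset.sum_mul_sum]
  simp_rw [hexp]
  have hmul : ∀ q ∈ incTuples (m + 2) n, ∀ q' ∈ incTuples (m + 2) n,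
      Integrable (fun ω => h (fun a => Z (q a) ω) * h (fun a => Z (q' a) ω)) P :=
    fun q hq q' hq' => (hLq q hq).integrable_mul (hLq q' hq')
  rw [integral_finsetSum _ fun q hq => integrable_finsetSum _ (hmul q hq)]
  calc ∑ q ∈ incTuples (m + 2) n, ∫ ω, ∑ q' ∈ incTuples (m + 2) n,
        h (fun a => Z (q a) ω) * h (fun a => Z (q' a) ω) ∂P
      ≤ ∑ q ∈ incTuples (m + 2) n, ((m + 2) ^ 4 * n ^ m : ℕ) * C := by
        refine Finset.sum_le_sum fun q hq => ?_
        rw [integral_finsetSum _ (hmul q hq)]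
        refine (Finset.sum_le_sum fun q' hq' => hle q hq q' hq').trans ?_
        rw [← Finset.sum_filter, Finset.sum_const, nsmul_eq_mul]
        refine mul_le_mul_of_nonneg_right (Nat.cast_le.2 ?_) hC0
        refine le_trans (Finset.card_le_card ?_)
          (card_tuples_two_common (mem_incTuples.1 hq).injective)
        exact Finset.filter_subset_filter _ (Finset.subset_univ _)
    _ ≤ ((m + 2) ^ 4 * n ^ (2 * m + 2) : ℕ) * C := by
        rw [Finset.sum_const, nsmul_eq_mul, ← mul_assoc, ← Nat.cast_mul]
        refine mul_le_mul_of_nonneg_right (Nat.cast_le.2 ?_) hC0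
        have : (incTuples (m + 2) n).card ≤ n ^ (m + 2) := by
          refine (Finset.card_le_univ _).trans ?_
          simp
        calc (incTuples (m + 2) n).card * ((m + 2) ^ 4 * n ^ m)
            ≤ n ^ (m + 2) * ((m + 2) ^ 4 * n ^ m) := Nat.mul_le_mul_right _ this
          _ = (m + 2) ^ 4 * n ^ (2 * m + 2) := by ring

end DegenerateSums

/-! ### Hoeffding decomposition and the central limit theorem for U-statistics. -/

section CentralLimit

open scoped Topology

variable {S Ω : Type*} [MeasurableSpace S] [MeasurableSpace Ω]
  {ν : Measure S} {P : Measure Ω} {Z : ℕ → Ω → S}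

lemma integral_comp_of_map_eq {T T' : Type*} [MeasurableSpace T] [MeasurableSpace T']
    {μ : Measure T} {μ' : Measure T'} {f : T → T'} (hf : AEMeasurable f μ) (hmap : μ.map f = μ')
    {g : T' → ℝ} (hg : AEStronglyMeasurable g μ') : ∫ x, g (f x) ∂μ = ∫ y, g y ∂μ' := by
  subst hmap
  exact (integral_map hf hg).symm

/-- The U-statistic of order `m` with kernel `k` at the sample points `w 0, …, w (n - 1)`. -/
def uStat {m : ℕ} (k : (Fin m → S) → ℝ) (n : ℕ) (w : ℕ → S) : ℝ :=
  (n.choose m : ℝ)⁻¹ * ∑ q ∈ incTuples m n, k (fun a => w (q a))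

/-- The kernel `k` with its mean and its first order part in the Hoeffding decomposition
subtracted. -/
def hoeffdingRemainder {m : ℕ} (ν : Measure S) (k : (Fin (m + 1) → S) → ℝ)
    (z : Fin (m + 1) → S) : ℝ :=
  k z - (∫ x, k x ∂(Measure.pi fun _ => ν)) -
    ∑ a, (firstProj ν k (z a) - ∫ x, k x ∂(Measure.pi fun _ => ν))

lemma measurable_hoeffdingRemainder [IsProbabilityMeasure ν] {m : ℕ} {k : (Fin (m + 1) → S) → ℝ}
    (hk : Measurable k) : Measurable (hoeffdingRemainder ν k) := by
  have := measurable_firstProj (ν := ν) hk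
  unfold hoeffdingRemainder
  fun_prop

lemma hoeffdingRemainder_comp_perm {m : ℕ} {k : (Fin (m + 1) → S) → ℝ}
    (hsymm : ∀ (σ : Equiv.Perm (Fin (m + 1))) z, k (z ∘ σ) = k z)
    (σ : Equiv.Perm (Fin (m + 1))) (z : Fin (m + 1) → S) :
    hoeffdingRemainder ν k (z ∘ σ) = hoeffdingRemainder ν k z := by
  simp only [hoeffdingRemainder, hsymm, Function.comp_apply]
  rw [Equiv.sum_comp σ fun a => firstProj ν k (z a) - ∫ x, k x ∂(Measure.pi fun _ => ν)]

lemma memLp_firstProj_eval [IsProbabilityMeasure ν] {m : ℕ} {g : S → ℝ} (hg : MemLp g 2 ν)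
    (a : Fin m) : MemLp (fun z : Fin m → S => g (z a)) 2 (Measure.pi fun _ => ν) :=
  hg.comp_measurePreserving (measurePreserving_eval (fun _ : Fin m => ν) a)

lemma memLp_hoeffdingRemainder [IsProbabilityMeasure ν] {m : ℕ} {k : (Fin (m + 1) → S) → ℝ}
    (hL : MemLp k 2 (Measure.pi fun _ => ν)) (hg : MemLp (firstProj ν k) 2 ν) :
    MemLp (hoeffdingRemainder ν k) 2 (Measure.pi fun _ => ν) := by
  unfold hoeffdingRemainder
  exact (hL.sub (memLp_const _)).sub
    (memLp_finsetSum _ fun a _ => (memLp_firstProj_eval hg a).sub (memLp_const _))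

/-- The summand at index zero cancels the centred projection of `k`, and the other summands
integrate to zero because `firstProj ν k` has the mean of `k`. The claim holds only almost
everywhere because Fubini gives integrable sections of `k` only for almost every `z`. -/
lemma firstProj_hoeffdingRemainder [IsProbabilityMeasure ν] {m : ℕ}
    {k : (Fin (m + 1) → S) → ℝ} (hk : Measurable k)
    (hL : MemLp k 2 (Measure.pi fun _ => ν)) (hg : MemLp (firstProj ν k) 2 ν) :
    ∀ᵐ z ∂ν, firstProj ν (hoeffdingRemainder ν k) z = 0 := by
  have hp := measurePreserving_finCons (m := m) ν
  have hi : Integrable k (Measure.pi fun _ : Fin (m + 1) => ν) := hL.integrable (by norm_num)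
  have hmean := integral_firstProj hk hi
  filter_upwards [(hp.integrable_comp_of_integrable hi).prod_right_ae] with z hz
  have hz' : Integrable (fun w : Fin m → S => k (Fin.cons z w)) (Measure.pi fun _ => ν) := hz
  rw [firstProj]
  simp only [hoeffdingRemainder, Fin.sum_univ_succ, Fin.cons_zero, Fin.cons_succ]
  set θ := ∫ x, k x ∂(Measure.pi fun _ : Fin (m + 1) => ν)
  have h1 : ∀ a : Fin m, Integrable (fun w : Fin m → S => firstProj ν k (w a) - θ)
      (Measure.pi fun _ => ν) := fun a =>
    ((memLp_firstProj_eval hg a).integrable (by norm_num)).sub (integrable_const _)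
  have h2 : ∀ a : Fin m, ∫ w : Fin m → S, (firstProj ν k (w a) - θ) ∂(Measure.pi fun _ => ν) = 0 := by
    intro a
    have hev := measurePreserving_eval (fun _ : Fin m => ν) a
    have h3 : ∫ w : Fin m → S, firstProj ν k (w a) ∂(Measure.pi fun _ => ν) = θ := by
      rw [← hmean]
      exact integral_comp_of_map_eq hev.measurable.aemeasurable hev.map_eq
        (measurable_firstProj hk).aestronglyMeasurable
    rw [integral_sub ((memLp_firstProj_eval hg a).integrable (by norm_num)) (integrable_const _), h3]
    simp
  have h3 : Integrable (fun w : Fin m → S => ∑ a, (firstProj ν k (w a) - θ))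
      (Measure.pi fun _ => ν) := integrable_finsetSum _ fun a _ => h1 a
  have h4 : Integrable (fun w : Fin m → S => k (Fin.cons z w) - θ) (Measure.pi fun _ => ν) :=
    hz'.sub (integrable_const _)
  have h5 : Integrable (fun w : Fin m → S => firstProj ν k z - θ +
      ∑ a, (firstProj ν k (w a) - θ)) (Measure.pi fun _ => ν) := (integrable_const _).add h3
  rw [integral_sub h4 h5, integral_sub hz' (integrable_const _),
    integral_add (integrable_const _) h3, integral_finsetSum _ fun a _ => h1 a]
  simp only [h2, Finset.sum_const_zero, integral_const, probReal_univ, one_smul, add_zero]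
  simp [firstProj]

/-- Each index occurs in `n.choose m` tuples, and the ratio of this to `(n + 1).choose (m + 1)` is
(m+1)/(n+1). The condition `m ≤ n` keeps the latter binomial coefficient nonzero. -/
lemma uStat_sub_mean {m n : ℕ} (hmn : m ≤ n) (ν : Measure S) (k : (Fin (m + 1) → S) → ℝ)
    (w : ℕ → S) :
    uStat k (n + 1) w - ∫ x, k x ∂(Measure.pi fun _ => ν) =
      (m + 1) / (n + 1) * ∑ i ∈ Finset.range (n + 1),
        (firstProj ν k (w i) - ∫ x, k x ∂(Measure.pi fun _ => ν)) +
      uStat (hoeffdingRemainder ν k) (n + 1) w := by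
  have hc : ((n + 1).choose (m + 1) : ℝ) ≠ 0 :=
    Nat.cast_ne_zero.2 (Nat.choose_pos (by omega)).ne'
  have hchoose : ((n : ℝ) + 1) * n.choose m = (n + 1).choose (m + 1) * (m + 1) := by
    exact_mod_cast Nat.add_one_mul_choose_eq n m
  have hn : (n : ℝ) + 1 ≠ 0 := by positivity
  set θ := ∫ x, k x ∂(Measure.pi fun _ : Fin (m + 1) => ν) with hθ
  have hsum := sum_incTuples_sum m n fun i => firstProj ν k (w i) - θ
  rw [Fin.sum_univ_eq_sum_range (fun i => firstProj ν k (w i) - θ)] at hsum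
  simp only [uStat, hoeffdingRemainder, ← hθ]
  have hconst : ∑ _q ∈ incTuples (m + 1) (n + 1), θ = (n + 1).choose (m + 1) * θ := by
    rw [Finset.sum_const, nsmul_eq_mul, card_incTuples]
  rw [Finset.sum_sub_distrib (s := incTuples (m + 1) (n + 1)),
    Finset.sum_sub_distrib (s := incTuples (m + 1) (n + 1)), hsum, hconst]
  generalize ∑ i ∈ Finset.range (n + 1), (firstProj ν k (w i) - θ) = A
  have : ((m : ℝ) + 1) / (n + 1) = ((n + 1).choose (m + 1) : ℝ)⁻¹ * n.choose m := by
    field_simp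
    linarith
  rw [this]
  field_simp
  ring

/-- Since `n.choose (m + 2)` is asymptotic to n^(m+2)/(m+2)!, the expression behaves like (m+2)!²/n.
-/
lemma tendsto_pow_div_choose_sq (m : ℕ) :
    Tendsto (fun n : ℕ => (n : ℝ) * ((n.choose (m + 2) : ℝ)⁻¹ ^ 2 *
      (n : ℝ) ^ (2 * m + 2))) atTop (𝓝 0) := by
  have h1 : Tendsto (fun n : ℕ => (n : ℝ) ^ (m + 2) / (n.choose (m + 2) : ℝ)) atTop
      (𝓝 ((m + 2).factorial : ℝ)) := by
    have h := (isEquivalent_choose (m + 2)).symm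
    have hne : ∀ᶠ n : ℕ in atTop, (n.choose (m + 2) : ℝ) ≠ 0 := by
      filter_upwards [eventually_ge_atTop (m + 2)] with n hn
      exact Nat.cast_ne_zero.2 (Nat.choose_pos hn).ne'
    have h2 := (Asymptotics.isEquivalent_iff_tendsto_one hne).1 h
    have h3 := h2.const_mul ((m + 2).factorial : ℝ)
    rw [mul_one] at h3
    refine h3.congr fun n => ?_
    have : ((m + 2).factorial : ℝ) ≠ 0 := Nat.cast_ne_zero.2 (Nat.factorial_ne_zero _)
    simp only [Pi.div_apply]
    field_simp
  have h2 := (tendsto_inv_atTop_nhds_zero_nat (𝕜 := ℝ)).mul (h1.pow 2)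
  rw [zero_mul] at h2
  refine h2.congr' ?_
  filter_upwards [eventually_gt_atTop 0] with n hn
  have : (n : ℝ) ≠ 0 := Nat.cast_ne_zero.2 hn.ne'
  field_simp
  ring

lemma tendstoInMeasure_zero_of_tendsto_integral_sq {D : ℕ → Ω → ℝ}
    (hD : ∀ n, AEStronglyMeasurable (D n) P) (hL : ∀ᶠ n in atTop, MemLp (D n) 2 P)
    (hlim : Tendsto (fun n => ∫ ω, D n ω ^ 2 ∂P) atTop (𝓝 0)) :
    TendstoInMeasure P D atTop 0 := by
  refine tendstoInMeasure_of_tendsto_eLpNorm (p := 2) two_ne_zero hD aestronglyMeasurable_zero ?_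
  have hsq := hlim.sqrt
  rw [Real.sqrt_zero] at hsq
  have h0 := ENNReal.tendsto_ofReal hsq
  rw [ENNReal.ofReal_zero] at h0
  refine h0.congr' ?_
  filter_upwards [hL] with n hn
  rw [sub_zero]
  refine Eq.trans ?_ (hn.eLpNorm_eq_integral_rpow_norm two_ne_zero ENNReal.ofNat_ne_top).symm
  simp [Real.sqrt_eq_rpow]

lemma memLp_uStat {m : ℕ} (hZ : ∀ i, AEMeasurable (Z i) P) (hlaw : ∀ i, P.map (Z i) = ν)
    (hind : iIndepFun Z P) {h : (Fin m → S) → ℝ} (hL : MemLp h 2 (Measure.pi fun _ => ν)) (n : ℕ) :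
    MemLp (fun ω => uStat h n (fun i => Z i ω)) 2 P := by
  have hq : ∀ q ∈ incTuples m n, MemLp (fun ω => h (fun a => Z (q a) ω)) 2 P := fun q hq =>
    memLp_comp_injective hZ hlaw hind
      (q := fun a => (q a : ℕ)) (Fin.val_injective.comp (mem_incTuples.1 hq).injective) hL
  have hsum : MemLp (fun ω => ∑ q ∈ incTuples m n, h (fun a => Z (q a) ω)) 2 P :=
    memLp_finsetSum _ hq
  exact hsum.const_mul _

/-- The U-statistic of a degenerate kernel is negligible at the scale `n ^ (-1/2)`. -/
lemma tendstoInMeasure_uStat_of_degenerate [IsProbabilityMeasure P] {m : ℕ}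
    (hZ : ∀ i, AEMeasurable (Z i) P) (hlaw : ∀ i, P.map (Z i) = ν) (hind : iIndepFun Z P)
    {h : (Fin (m + 2) → S) → ℝ} (hm : Measurable h)
    (hsymm : ∀ (σ : Equiv.Perm (Fin (m + 2))) z, h (z ∘ σ) = h z)
    (hL : MemLp h 2 (Measure.pi fun _ => ν)) (hdeg : ∀ᵐ z ∂ν, firstProj ν h z = 0) :
    TendstoInMeasure P (fun (n : ℕ) ω => √n * uStat h n (fun i => Z i ω)) atTop 0 := by
  have hU := fun n : ℕ => (memLp_uStat hZ hlaw hind hL n).const_mul √n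
  refine tendstoInMeasure_zero_of_tendsto_integral_sq (fun n => (hU n).1)
    (Eventually.of_forall hU) ?_
  set C : ℝ := ∫ z, h z ^ 2 ∂(Measure.pi fun _ => ν)
  have hlim := (tendsto_pow_div_choose_sq m).const_mul (((m : ℝ) + 2) ^ 4 * C)
  rw [mul_zero] at hlim
  refine squeeze_zero (fun n => integral_nonneg fun ω => sq_nonneg _) (fun n => ?_) hlim
  simp_rw [uStat, mul_pow, Real.sq_sqrt (Nat.cast_nonneg n)]
  rw [integral_const_mul, integral_const_mul]
  have hb := integral_sum_sq_le hZ hlaw hind hm hsymm hL hdeg n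
  push_cast at hb
  refine (mul_le_mul_of_nonneg_left (mul_le_mul_of_nonneg_left hb (sq_nonneg _))
    (Nat.cast_nonneg n)).trans_eq ?_
  ring

/-- **Hoeffding's theorem**: the central limit theorem for U-statistics with a square integrable
symmetric kernel. -/
theorem tendstoInDistribution_uStat [IsProbabilityMeasure P] [IsProbabilityMeasure ν] {m : ℕ}
    (hZ : ∀ i, AEMeasurable (Z i) P) (hlaw : ∀ i, P.map (Z i) = ν) (hind : iIndepFun Z P)
    {k : (Fin (m + 2) → S) → ℝ} (hk : Measurable k)
    (hsymm : ∀ (σ : Equiv.Perm (Fin (m + 2))) z, k (z ∘ σ) = k z)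
    (hL : MemLp k 2 (Measure.pi fun _ => ν)) (hg : MemLp (firstProj ν k) 2 ν) :
    TendstoInDistribution
      (fun (n : ℕ) ω => √n * (uStat k n (fun i => Z i ω) - ∫ x, k x ∂(Measure.pi fun _ => ν)))
      atTop (id : ℝ → ℝ) (fun _ => P)
      (gaussianReal 0 ((m + 2 : ℝ) ^ 2 * Var[firstProj ν k; ν]).toNNReal) := by
  set θ := ∫ x, k x ∂(Measure.pi fun _ : Fin (m + 2) => ν) with hθ
  have hgm := measurable_firstProj (ν := ν) hk
  have hmean : ∫ z, firstProj ν k z ∂ν = θ :=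
    integral_firstProj hk (hL.integrable (by norm_num))
  -- The order `m + 2` of the kernel is absorbed into the summands, whence its square in the
  -- limiting variance.
  let X : ℕ → Ω → ℝ := fun i ω => (m + 2) * firstProj ν k (Z i ω)
  have hXm : ∀ i, AEMeasurable (X i) P := fun i =>
    (hgm.comp_aemeasurable (hZ i)).const_mul _
  have hXind : iIndepFun X P := hind.comp (fun _ x => (m + 2) * firstProj ν k x)
    fun _ => hgm.const_mul _
  have hXid : ∀ i, IdentDistrib (X i) (X 0) P P := by
    intro i
    have : IdentDistrib (Z i) (Z 0) P P := ⟨hZ i, hZ 0, by rw [hlaw, hlaw]⟩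
    exact this.comp (hgm.const_mul _)
  have hg0 : MemLp (fun ω => firstProj ν k (Z 0 ω)) 2 P := by
    have := hlaw 0
    exact (memLp_map_measure_iff (by rw [this]; exact hg.1) (hZ 0)).1 (by rw [this]; exact hg)
  have hX0 : MemLp (X 0) 2 P := hg0.const_mul _
  have hXmean : ∫ ω, X 0 ω ∂P = (m + 2) * θ := by
    simp only [X]
    rw [integral_const_mul, ← hmean,
      integral_comp_of_map_eq (hZ 0) (hlaw 0) hgm.aestronglyMeasurable]
  have hXvar : Var[X 0; P] = (m + 2 : ℝ) ^ 2 * Var[firstProj ν k; ν] := by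
    simp only [X]
    rw [variance_const_mul]
    congr 1
    have h := variance_map (X := firstProj ν k) (μ := P) (Y := Z 0)
      (by rw [hlaw 0]; exact hgm.aemeasurable) (hZ 0)
    rw [hlaw 0] at h
    rw [h]; rfl
  have hclt := tendstoInDistribution_inv_sqrt_mul_sum_sub (Y := (id : ℝ → ℝ))
    (P' := gaussianReal 0 (Var[X 0; P]).toNNReal) ⟨aemeasurable_id, Measure.map_id⟩ hX0 hXind hXid
  rw [hXmean] at hclt
  simp only [hXvar] at hclt
  have hUm : ∀ n, AEMeasurable (fun ω => uStat k n (fun i => Z i ω)) P := fun n =>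
    (Finset.aemeasurable_fun_sum _ fun q _ =>
      hk.comp_aemeasurable (aemeasurable_comp hZ fun a => (q a : ℕ))).const_mul _
  refine tendstoInDistribution_of_tendstoInMeasure_sub _ _ hclt ?_
    fun n => ((hUm n).sub_const _).const_mul _
  -- For n at least the order of the kernel, the distance to the normalised i.i.d. sum is exactly
  -- the degenerate part, which tends to zero in measure; a Slutsky argument then transfers the
  -- limit.
  have hdiff : ∀ n : ℕ, m + 2 ≤ n → ∀ ω,
      √n * (uStat k n (fun i => Z i ω) - θ) -
        (√n)⁻¹ * (∑ i ∈ Finset.range n, X i ω - n * ((m + 2) * θ)) =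
      √n * uStat (hoeffdingRemainder ν k) n (fun i => Z i ω) := by
    intro n hn ω
    obtain ⟨n, rfl⟩ : ∃ n', n = n' + 1 := ⟨n - 1, by omega⟩
    rw [uStat_sub_mean (by omega) ν k, mul_add]
    have hs : √((n + 1 : ℕ) : ℝ) * √((n + 1 : ℕ) : ℝ) = (n + 1 : ℕ) :=
      Real.mul_self_sqrt (Nat.cast_nonneg _)
    have hs0 : √((n + 1 : ℕ) : ℝ) ≠ 0 := (Real.sqrt_pos.2 (by positivity)).ne'
    simp only [X]
    rw [Finset.sum_sub_distrib, ← Finset.mul_sum, Finset.sum_const, nsmul_eq_mul, Finset.card_range]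
    push_cast at hs hs0 ⊢
    generalize √((n : ℝ) + 1) = s at hs hs0 ⊢
    rw [← hθ, ← hs]
    field_simp
    ring
  refine (tendstoInMeasure_uStat_of_degenerate hZ hlaw hind (measurable_hoeffdingRemainder hk)
    (hoeffdingRemainder_comp_perm hsymm) (memLp_hoeffdingRemainder hL hg)
    (firstProj_hoeffdingRemainder hk hL hg)).congr' ?_ EventuallyEq.rfl
  filter_upwards [eventually_ge_atTop (m + 2)] with n hn
  exact Eventually.of_forall fun ω => (hdiff n hn ω).symm

end CentralLimit

/-! ### The integral representation of ‖x‖^α. -/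

section FractionalNorm

lemma lintegral_rpow_mul_exp_neg_mul {a r : ℝ} (ha : 0 < a) (hr : 0 < r) :
    ∫⁻ s in Set.Ioi (0 : ℝ), ENNReal.ofReal (s ^ (a - 1) * Real.exp (-(r * s))) =
      ENNReal.ofReal ((1 / r) ^ a * Real.Gamma a) := by
  have h := Real.integral_rpow_mul_exp_neg_mul_Ioi ha hr
  have hpos : 0 < (1 / r) ^ a * Real.Gamma a := by
    have := Real.Gamma_pos_of_pos ha
    positivity
  rw [← h] at hpos ⊢
  -- Integrability is read off from the nonzero value: the integral of a non-integrable function is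
  -- zero by convention.
  have hi : IntegrableOn (fun s : ℝ => s ^ (a - 1) * Real.exp (-(r * s))) (Set.Ioi 0) := by
    by_contra hn
    exact hpos.ne' (integral_undef hn)
  rw [ofReal_integral_eq_lintegral_ofReal hi]
  filter_upwards [ae_restrict_mem measurableSet_Ioi] with s hs
  have : 0 ≤ s := le_of_lt hs
  simp only [Pi.zero_apply]
  positivity

/-- The substitution y = 1/s reduces this to the Gamma integral. -/
lemma lintegral_rpow_mul_exp_neg_div {b r : ℝ} (hb : 0 < b) (hr : 0 < r) :
    ∫⁻ s in Set.Ioi (0 : ℝ), ENNReal.ofReal (s ^ (-1 - b) * Real.exp (-(r / s))) =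
      ENNReal.ofReal ((1 / r) ^ b * Real.Gamma b) := by
  have h := integral_comp_rpow_Ioi (fun y : ℝ => y ^ (b - 1) * Real.exp (-(r * y)))
    (p := -1) (by norm_num)
  rw [Real.integral_rpow_mul_exp_neg_mul_Ioi hb hr] at h
  have h' : ∫ s in Set.Ioi (0 : ℝ), s ^ (-1 - b) * Real.exp (-(r / s)) =
      (1 / r) ^ b * Real.Gamma b := by
    rw [← h]
    refine setIntegral_congr_fun measurableSet_Ioi fun s hs => ?_
    have hs : 0 < s := hs
    have h1 : s ^ (-1 - b) = s ^ ((-1 : ℝ) - 1) * (s ^ (-1 : ℝ)) ^ (b - 1) := by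
      rw [← Real.rpow_mul hs.le, ← Real.rpow_add hs]
      ring_nf
    simp only [smul_eq_mul, abs_neg, abs_one, one_mul]
    rw [h1, mul_assoc, Real.rpow_neg_one, div_eq_mul_inv]
  have hpos : 0 < (1 / r) ^ b * Real.Gamma b := by
    have := Real.Gamma_pos_of_pos hb
    positivity
  rw [← h'] at hpos ⊢
  have hi : IntegrableOn (fun s : ℝ => s ^ (-1 - b) * Real.exp (-(r / s))) (Set.Ioi 0) := by
    by_contra hn
    exact hpos.ne' (integral_undef hn)
  rw [ofReal_integral_eq_lintegral_ofReal hi]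
  filter_upwards [ae_restrict_mem measurableSet_Ioi] with s hs
  have : 0 ≤ s := le_of_lt hs
  simp only [Pi.zero_apply]
  positivity

lemma lintegral_inv_mul_exp_neg_div {R s : ℝ} (hR : 0 ≤ R) (hs : 0 < s) :
    ∫⁻ r in Set.Ioc 0 R, ENNReal.ofReal (s⁻¹ * Real.exp (-(r / s))) =
      ENNReal.ofReal (1 - Real.exp (-(R / s))) := by
  have hd : ∀ r : ℝ, HasDerivAt (fun r => -Real.exp (-(r / s))) (s⁻¹ * Real.exp (-(r / s))) r := by
    intro r
    have h1 : HasDerivAt (fun r : ℝ => -(r / s)) (-(1 / s)) r := ((hasDerivAt_id r).div_const s).neg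
    convert! h1.exp.neg using 1
    rw [one_div]; ring
  have hc : Continuous fun r : ℝ => s⁻¹ * Real.exp (-(r / s)) := by fun_prop
  have h := intervalIntegral.integral_eq_sub_of_hasDerivAt (fun r _ => hd r)
    (hc.intervalIntegrable 0 R)
  rw [intervalIntegral.integral_of_le hR] at h
  simp only [zero_div, neg_zero, Real.exp_zero, sub_neg_eq_add] at h
  rw [← ofReal_integral_eq_lintegral_ofReal, h]
  · congr 1; ring
  · exact (hc.intervalIntegrable 0 R).1
  · exact Eventually.of_forall fun r => by simp only [Pi.zero_apply]; positivity

lemma lintegral_Ioc_rpow {R b : ℝ} (hR : 0 ≤ R) (hb : 0 < b) :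
    ∫⁻ r in Set.Ioc 0 R, ENNReal.ofReal (r ^ (b - 1)) = ENNReal.ofReal (R ^ b / b) := by
  have h := integral_rpow (a := 0) (b := R) (r := b - 1) (Or.inl (by linarith))
  have hi := intervalIntegral.intervalIntegrable_rpow' (a := 0) (b := R) (r := b - 1) (by linarith)
  rw [intervalIntegral.integral_of_le hR, sub_add_cancel, Real.zero_rpow hb.ne', sub_zero] at h
  rw [← h, ofReal_integral_eq_lintegral_ofReal hi.1]
  filter_upwards [ae_restrict_mem measurableSet_Ioc] with r hr
  exact Real.rpow_nonneg hr.1.le _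

/-- Write 1 - exp(-R/s) as the integral of s⁻¹ exp(-r/s) over 0 < r ≤ R and exchange the integrals
by Tonelli. The s-integral is Γ(1 - α/2) r^(α/2 - 1), where α < 2 is needed, and α > 0 makes this
integrable at r = 0. -/
lemma lintegral_rpow_mul_one_sub_exp {α R : ℝ} (hα0 : 0 < α) (hα2 : α < 2) (hR : 0 ≤ R) :
    ∫⁻ s in Set.Ioi (0 : ℝ), ENNReal.ofReal (s ^ (α / 2 - 1) * (1 - Real.exp (-(R / s)))) =
      ENNReal.ofReal (Real.Gamma (1 - α / 2) * (R ^ (α / 2) / (α / 2))) := by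
  have hΓ : 0 < Real.Gamma (1 - α / 2) := Real.Gamma_pos_of_pos (by linarith)
  calc ∫⁻ s in Set.Ioi (0 : ℝ), ENNReal.ofReal (s ^ (α / 2 - 1) * (1 - Real.exp (-(R / s))))
      = ∫⁻ s in Set.Ioi (0 : ℝ), ∫⁻ r in Set.Ioc 0 R,
          ENNReal.ofReal (s ^ (-1 - (1 - α / 2)) * Real.exp (-(r / s))) := by
        refine setLIntegral_congr_fun measurableSet_Ioi fun s hs => ?_
        have hs : 0 < s := hs
        rw [ENNReal.ofReal_mul (Real.rpow_nonneg hs.le _), ← lintegral_inv_mul_exp_neg_div hR hs,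
          ← lintegral_const_mul _ (by fun_prop)]
        refine lintegral_congr fun r => ?_
        rw [← ENNReal.ofReal_mul (Real.rpow_nonneg hs.le _), ← mul_assoc, ← Real.rpow_neg_one,
          ← Real.rpow_add hs]
        congr 3
        ring_nf
    _ = ∫⁻ r in Set.Ioc 0 R, ∫⁻ s in Set.Ioi (0 : ℝ),
          ENNReal.ofReal (s ^ (-1 - (1 - α / 2)) * Real.exp (-(r / s))) :=
        lintegral_lintegral_swap (by fun_prop)
    _ = ∫⁻ r in Set.Ioc 0 R, ENNReal.ofReal (Real.Gamma (1 - α / 2)) *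
          ENNReal.ofReal (r ^ (α / 2 - 1)) := by
        refine setLIntegral_congr_fun measurableSet_Ioc fun r hr => ?_
        rw [lintegral_rpow_mul_exp_neg_div (by linarith) hr.1, ← ENNReal.ofReal_mul hΓ.le, mul_comm,
          one_div, Real.inv_rpow hr.1.le, ← Real.rpow_neg hr.1.le]
        congr 3
        ring
    _ = _ := by
        rw [lintegral_const_mul _ (by fun_prop), lintegral_Ioc_rpow hR (by linarith),
          ← ENNReal.ofReal_mul hΓ.le]

variable {p : ℕ}

lemma integrable_exp_neg_mul_norm_sq {s : ℝ} (hs : 0 < s) :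
    Integrable (fun t : E p => Real.exp (-(s * ‖t‖ ^ 2))) := by
  have := (GaussianFourier.integrable_cexp_neg_mul_sq_norm_add (V := E p) (b := (s : ℂ))
    (by simpa using hs) 0 0).re
  refine this.congr (Eventually.of_forall fun t => ?_)
  have : (-(s : ℂ) * (‖t‖ : ℂ) ^ 2 + 0 * ((inner ℝ (0 : E p) t : ℝ) : ℂ)) =
      ((-(s * ‖t‖ ^ 2) : ℝ) : ℂ) := by push_cast; ring
  simp only [this]
  rw [← Complex.ofReal_exp]
  rfl

/-- This is the real part of the Fourier transform of a Gaussian. -/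
lemma integral_cos_mul_exp_neg_mul_norm_sq {s : ℝ} (hs : 0 < s) (x : E p) :
    ∫ t : E p, Real.cos ⟪t, x⟫ * Real.exp (-(s * ‖t‖ ^ 2)) =
      (Real.pi / s) ^ ((p : ℝ) / 2) * Real.exp (-(‖x‖ ^ 2 / 4 / s)) := by
  have hre : 0 < (s : ℂ).re := by simpa using hs
  have h := GaussianFourier.integral_cexp_neg_mul_sq_norm_add (V := E p) hre Complex.I x
  have hi := GaussianFourier.integrable_cexp_neg_mul_sq_norm_add (V := E p) hre Complex.I x
  have h2 := congrArg Complex.re h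
  rw [← RCLike.re_eq_complex_re, ← integral_re hi] at h2
  have h3 : ∀ t : E p, RCLike.re (Complex.exp (-(s : ℂ) * (‖t‖ : ℂ) ^ 2 +
      Complex.I * ((inner ℝ x t : ℝ) : ℂ))) = Real.cos ⟪t, x⟫ * Real.exp (-(s * ‖t‖ ^ 2)) := by
    intro t
    rw [RCLike.re_eq_complex_re, Complex.exp_re, real_inner_comm]
    have e1 : (-(s : ℂ) * (‖t‖ : ℂ) ^ 2 + Complex.I * ((inner ℝ t x : ℝ) : ℂ)) =
      ((-(s * ‖t‖ ^ 2) : ℝ) : ℂ) + ((inner ℝ t x : ℝ) : ℂ) * Complex.I := by push_cast; ring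
    rw [e1]
    simp only [Complex.add_re, Complex.add_im, Complex.ofReal_re, Complex.ofReal_im,
      Complex.re_ofReal_mul, Complex.im_ofReal_mul, Complex.I_re, Complex.I_im]
    ring_nf
  simp_rw [h3] at h2
  rw [h2]
  have e2 : ((Real.pi : ℂ) / s) ^ ((Module.finrank ℝ (E p) : ℂ) / 2) *
      Complex.exp (Complex.I ^ 2 * (‖x‖ : ℂ) ^ 2 / (4 * s)) =
      (((Real.pi / s) ^ ((p : ℝ) / 2) * Real.exp (-(‖x‖ ^ 2 / 4 / s)) : ℝ) : ℂ) := by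
    rw [Complex.ofReal_mul, Complex.ofReal_cpow (by positivity), Complex.ofReal_exp]
    simp only [finrank_euclideanSpace, Fintype.card_fin, Complex.I_sq]
    push_cast
    congr 2
    field_simp
  rw [e2]
  rfl

lemma lintegral_one_sub_cos_mul_exp {s : ℝ} (hs : 0 < s) (x : E p) :
    ∫⁻ t : E p, ENNReal.ofReal ((1 - Real.cos ⟪t, x⟫) * Real.exp (-(s * ‖t‖ ^ 2))) =
      ENNReal.ofReal ((Real.pi / s) ^ ((p : ℝ) / 2) * (1 - Real.exp (-(‖x‖ ^ 2 / 4 / s)))) := by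
  have h0 := integral_cos_mul_exp_neg_mul_norm_sq hs (0 : E p)
  have h1 := integral_cos_mul_exp_neg_mul_norm_sq hs x
  simp only [inner_zero_right, Real.cos_zero, one_mul, norm_zero, ne_eq, OfNat.ofNat_ne_zero,
    not_false_eq_true, zero_pow, zero_div, neg_zero, Real.exp_zero, mul_one] at h0
  have hi := integrable_exp_neg_mul_norm_sq (p := p) hs
  have hic : Integrable (fun t : E p => Real.cos ⟪t, x⟫ * Real.exp (-(s * ‖t‖ ^ 2))) := by
    refine hi.bdd_mul (c := 1) (by fun_prop) (Eventually.of_forall fun t => ?_)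
    exact Real.abs_cos_le_one _
  have hint : ∫ t : E p, (1 - Real.cos ⟪t, x⟫) * Real.exp (-(s * ‖t‖ ^ 2)) =
      (Real.pi / s) ^ ((p : ℝ) / 2) * (1 - Real.exp (-(‖x‖ ^ 2 / 4 / s))) := by
    simp_rw [sub_mul, one_mul]
    rw [integral_sub hi hic, h0, h1]
    ring
  rw [← hint, ofReal_integral_eq_lintegral_ofReal]
  · simp_rw [sub_mul, one_mul]
    exact hi.sub hic
  · refine Eventually.of_forall fun t => mul_nonneg ?_ (Real.exp_nonneg _)
    linarith [Real.cos_le_one ⟪t, x⟫]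

lemma c_pos (p : ℕ) {α : ℝ} (hα0 : 0 < α) (hα2 : α < 2) : 0 < c p α := by
  have h1 : 0 < Real.Gamma (1 - α / 2) := Real.Gamma_pos_of_pos (by linarith)
  have h2 : 0 < Real.Gamma ((α + p) / 2) := Real.Gamma_pos_of_pos (by positivity)
  have := Real.pi_pos
  unfold c
  positivity

lemma rho_nonneg {α : ℝ} (hα0 : 0 < α) (hα2 : α < 2) (t : E p) : 0 ≤ rho α t :=
  mul_nonneg (inv_nonneg.2 (c_pos p hα0 hα2).le) (Real.rpow_nonneg (norm_nonneg _) _)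

lemma measurable_rho {α : ℝ} : Measurable (rho α : E p → ℝ) := by
  unfold rho
  fun_prop

/-- The weight is a mixture of Gaussians: with a = (α + p)/2, Γ(a) ‖t‖^(-α-p) is the integral of
s^(a-1) exp(-s‖t‖²) over s > 0. After Tonelli the Gaussian integral in t produces (π/s)^(p/2), which
lowers the exponent a - 1 to α/2 - 1, and the remaining integral in s, taken at R = ‖x‖²/4, produces
‖x‖^α. The constant `c p α` is exactly what normalises the result. -/
lemma lintegral_one_sub_cos_mul_rho {α : ℝ} (hα0 : 0 < α) (hα2 : α < 2) (x : E p) :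
    ∫⁻ t : E p, ENNReal.ofReal ((1 - Real.cos ⟪t, x⟫) * rho α t) = ENNReal.ofReal (‖x‖ ^ α) := by
  have hc := c_pos p hα0 hα2
  set a : ℝ := (α + p) / 2 with ha
  have ha0 : 0 < a := by positivity
  have hΓ : 0 < Real.Gamma a := Real.Gamma_pos_of_pos ha0
  have hΓ' : 0 < Real.Gamma (1 - α / 2) := Real.Gamma_pos_of_pos (by linarith)
  have hcos : ∀ t : E p, 0 ≤ 1 - Real.cos ⟪t, x⟫ := fun t => by
    linarith [Real.cos_le_one ⟪t, x⟫]
  have hκ : 0 ≤ (c p α * Real.Gamma a)⁻¹ := by positivity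
  calc ∫⁻ t : E p, ENNReal.ofReal ((1 - Real.cos ⟪t, x⟫) * rho α t)
      = ∫⁻ t : E p, ENNReal.ofReal (c p α * Real.Gamma a)⁻¹ * ∫⁻ s in Set.Ioi (0 : ℝ),
          ENNReal.ofReal (s ^ (a - 1) *
            ((1 - Real.cos ⟪t, x⟫) * Real.exp (-(s * ‖t‖ ^ 2)))) := by
        refine lintegral_congr fun t => ?_
        -- At t = 0 the Gamma formula is unavailable, but both sides vanish because 1 - cos 0 = 0.
        by_cases ht : t = 0
        · simp [ht]
        have ht2 : 0 < ‖t‖ ^ 2 := by positivity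
        have h1 : ∫⁻ s in Set.Ioi (0 : ℝ),
            ENNReal.ofReal (s ^ (a - 1) * ((1 - Real.cos ⟪t, x⟫) * Real.exp (-(s * ‖t‖ ^ 2)))) =
            ENNReal.ofReal (1 - Real.cos ⟪t, x⟫) * ∫⁻ s in Set.Ioi (0 : ℝ),
              ENNReal.ofReal (s ^ (a - 1) * Real.exp (-(‖t‖ ^ 2 * s))) := by
          rw [← lintegral_const_mul _ (by fun_prop)]
          refine lintegral_congr fun s => ?_
          rw [← ENNReal.ofReal_mul (hcos t)]
          congr 1
          ring_nf
        rw [h1, lintegral_rpow_mul_exp_neg_mul ha0 ht2, ← ENNReal.ofReal_mul (hcos t),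
          ← ENNReal.ofReal_mul hκ]
        congr 1
        have h2 : (1 / ‖t‖ ^ 2) ^ a = ‖t‖ ^ (-α - p) := by
          rw [one_div, ← Real.rpow_natCast, ← Real.rpow_neg (norm_nonneg _),
            ← Real.rpow_mul (norm_nonneg _), ha]
          congr 1
          push_cast
          ring
        rw [h2, rho]
        field_simp
    _ = ENNReal.ofReal (c p α * Real.Gamma a)⁻¹ * ∫⁻ s in Set.Ioi (0 : ℝ), ∫⁻ t : E p,
          ENNReal.ofReal (s ^ (a - 1) *
            ((1 - Real.cos ⟪t, x⟫) * Real.exp (-(s * ‖t‖ ^ 2)))) := by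
        rw [lintegral_const_mul' _ _ ENNReal.ofReal_ne_top,
          lintegral_lintegral_swap (by fun_prop)]
    _ = ENNReal.ofReal (c p α * Real.Gamma a)⁻¹ * ∫⁻ s in Set.Ioi (0 : ℝ),
          ENNReal.ofReal (Real.pi ^ ((p : ℝ) / 2)) *
          ENNReal.ofReal (s ^ (α / 2 - 1) * (1 - Real.exp (-(‖x‖ ^ 2 / 4 / s)))) := by
        congr 1
        refine setLIntegral_congr_fun measurableSet_Ioi fun s hs => ?_
        have hs : 0 < s := hs
        simp_rw [ENNReal.ofReal_mul (Real.rpow_nonneg hs.le (a - 1))]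
        rw [lintegral_const_mul' _ _ ENNReal.ofReal_ne_top, lintegral_one_sub_cos_mul_exp hs,
          ← ENNReal.ofReal_mul (Real.rpow_nonneg hs.le _),
          ← ENNReal.ofReal_mul (Real.rpow_nonneg Real.pi_pos.le _)]
        congr 1
        rw [Real.div_rpow Real.pi_pos.le hs.le, ← mul_assoc, ← mul_assoc]
        congr 1
        have : s ^ (a - 1) = s ^ (α / 2 - 1) * s ^ ((p : ℝ) / 2) := by
          rw [← Real.rpow_add hs, ha]
          congr 1
          ring
        rw [this]
        have : s ^ ((p : ℝ) / 2) ≠ 0 := (Real.rpow_pos_of_pos hs _).ne'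
        field_simp
    _ = ENNReal.ofReal (‖x‖ ^ α) := by
        rw [lintegral_const_mul' _ _ ENNReal.ofReal_ne_top,
          lintegral_rpow_mul_one_sub_exp hα0 hα2 (by positivity),
          ← ENNReal.ofReal_mul (Real.rpow_nonneg Real.pi_pos.le _), ← ENNReal.ofReal_mul hκ]
        congr 1
        have h4 : (‖x‖ ^ 2 / 4) ^ (α / 2) = ‖x‖ ^ α / 2 ^ α := by
          have : ‖x‖ ^ 2 / 4 = (‖x‖ / 2) ^ (2 : ℝ) := by
            rw [Real.rpow_two]; ring
          rw [this, ← Real.rpow_mul (by positivity), mul_div_cancel₀ _ (two_ne_zero),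
            Real.div_rpow (norm_nonneg _) two_pos.le]
        rw [h4, c, ← ha]
        have h5 : (2 : ℝ) ^ α ≠ 0 := (Real.rpow_pos_of_pos two_pos _).ne'
        have h6 : Real.pi ^ ((p : ℝ) / 2) ≠ 0 := (Real.rpow_pos_of_pos Real.pi_pos _).ne'
        generalize Real.Gamma (1 - α / 2) = G at hΓ' ⊢
        field_simp

lemma integrable_one_sub_cos_mul_rho {α : ℝ} (hα0 : 0 < α) (hα2 : α < 2) (x : E p) :
    Integrable (fun t : E p => (1 - Real.cos ⟪t, x⟫) * rho α t) := by
  have := measurable_rho (p := p) (α := α)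
  refine ⟨by fun_prop, ?_⟩
  rw [hasFiniteIntegral_iff_ofReal, lintegral_one_sub_cos_mul_rho hα0 hα2]
  · exact ENNReal.ofReal_lt_top
  · exact Eventually.of_forall fun t => mul_nonneg (by linarith [Real.cos_le_one ⟪t, x⟫])
      (rho_nonneg hα0 hα2 t)

/-- The representation of the `α`-th power of the norm by the weight `ρ_α`. -/
lemma integral_one_sub_cos_mul_rho {α : ℝ} (hα0 : 0 < α) (hα2 : α < 2) (x : E p) :
    ∫ t : E p, (1 - Real.cos ⟪t, x⟫) * rho α t = ‖x‖ ^ α := by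
  have hnn : ∀ t : E p, 0 ≤ (1 - Real.cos ⟪t, x⟫) * rho α t := fun t =>
    mul_nonneg (by linarith [Real.cos_le_one ⟪t, x⟫]) (rho_nonneg hα0 hα2 t)
  rw [integral_eq_lintegral_of_nonneg_ae (Eventually.of_forall hnn)
    (integrable_one_sub_cos_mul_rho hα0 hα2 x).1, lintegral_one_sub_cos_mul_rho hα0 hα2,
    ENNReal.toReal_ofReal (Real.rpow_nonneg (norm_nonneg _) _)]

end FractionalNorm

/-! ### The kernel as an algebraic expression in increments. -/

section KernelAlgebra

/-- Nested sums with an indicator of distinctness can be written out term by term, as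
`kernelComb_one_sub_re` requires; the versions for three and four indices serve the same end. -/
lemma sum_embedding_two (f : Fin 4 → Fin 4 → ℝ) :
    ∑ s : Fin 2 ↪ Fin 4, f (s 0) (s 1) = ∑ i, ∑ j, if i ≠ j then f i j else 0 := by
  rw [← Fintype.sum_prod_type' (f := fun i j => if i ≠ j then f i j else 0), ← Finset.sum_filter]
  refine Finset.sum_bij' (fun s _ => (s 0, s 1))
    (fun x hx => ⟨![x.1, x.2], by
      have h := (Finset.mem_filter.1 hx).2
      intro a b hab
      fin_cases a <;> fin_cases b <;> simp_all [eq_comm]⟩) ?_ ?_ ?_ ?_ ?_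
  · intro s _
    simp
  · intro x hx
    simp
  · intro s _
    ext a
    fin_cases a <;> rfl
  · intro x hx
    rfl
  · intro s _
    rfl

lemma sum_embedding_three (f : Fin 4 → Fin 4 → Fin 4 → ℝ) :
    ∑ s : Fin 3 ↪ Fin 4, f (s 0) (s 1) (s 2) =
      ∑ i, ∑ j, ∑ k, if i ≠ j ∧ i ≠ k ∧ j ≠ k then f i j k else 0 := by
  rw [← Fintype.sum_prod_type' (f := fun i j => ∑ k, if i ≠ j ∧ i ≠ k ∧ j ≠ k then f i j k else 0),
    ← Fintype.sum_prod_type' (f := fun (x : Fin 4 × Fin 4) k =>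
      if x.1 ≠ x.2 ∧ x.1 ≠ k ∧ x.2 ≠ k then f x.1 x.2 k else 0), ← Finset.sum_filter]
  refine Finset.sum_bij' (fun s _ => ((s 0, s 1), s 2))
    (fun x hx => ⟨![x.1.1, x.1.2, x.2], by
      have h := (Finset.mem_filter.1 hx).2
      intro a b hab
      fin_cases a <;> fin_cases b <;> simp_all [eq_comm]⟩) ?_ ?_ ?_ ?_ ?_
  · intro s _
    simp
  · intro x hx
    simp
  · intro s _
    ext a
    fin_cases a <;> rfl
  · intro x hx
    rfl
  · intro s _
    rfl

lemma injective_vec_four {a b c d : Fin 4}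
    (h : a ≠ b ∧ a ≠ c ∧ a ≠ d ∧ b ≠ c ∧ b ≠ d ∧ c ≠ d) : Function.Injective ![a, b, c, d] := by
  obtain ⟨h1, h2, h3, h4, h5, h6⟩ := h
  intro i j hij
  fin_cases i <;> fin_cases j <;>
    first
    | rfl
    | exact absurd hij h1 | exact absurd hij h2 | exact absurd hij h3
    | exact absurd hij h4 | exact absurd hij h5 | exact absurd hij h6
    | exact absurd hij h1.symm | exact absurd hij h2.symm | exact absurd hij h3.symm
    | exact absurd hij h4.symm | exact absurd hij h5.symm | exact absurd hij h6.symm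

lemma sum_embedding_four (f : Fin 4 → Fin 4 → Fin 4 → Fin 4 → ℝ) :
    ∑ s : Fin 4 ↪ Fin 4, f (s 0) (s 1) (s 2) (s 3) =
      ∑ i, ∑ j, ∑ k, ∑ l,
        if i ≠ j ∧ i ≠ k ∧ i ≠ l ∧ j ≠ k ∧ j ≠ l ∧ k ≠ l then f i j k l else 0 := by
  have h : ∑ i, ∑ j, ∑ k, ∑ l,
        (if i ≠ j ∧ i ≠ k ∧ i ≠ l ∧ j ≠ k ∧ j ≠ l ∧ k ≠ l then f i j k l else 0) =
      ∑ x : Fin 4 × Fin 4 × Fin 4 × Fin 4,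
        if x.1 ≠ x.2.1 ∧ x.1 ≠ x.2.2.1 ∧ x.1 ≠ x.2.2.2 ∧ x.2.1 ≠ x.2.2.1 ∧ x.2.1 ≠ x.2.2.2 ∧
          x.2.2.1 ≠ x.2.2.2 then f x.1 x.2.1 x.2.2.1 x.2.2.2 else 0 := by
    simp only [Fintype.sum_prod_type]
  rw [h, ← Finset.sum_filter]
  refine Finset.sum_bij' (fun s _ => (s 0, s 1, s 2, s 3))
    (fun x hx => ⟨![x.1, x.2.1, x.2.2.1, x.2.2.2],
      injective_vec_four (Finset.mem_filter.1 hx).2⟩) ?_ ?_ ?_ ?_ ?_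
  · intro s _
    simp
  · intro x hx
    simp
  · intro s _
    ext a
    fin_cases a <;> rfl
  · intro x hx
    rfl
  · intro s _
    rfl

/-- The combination of values of `F` which defines `kernel`. -/
def kernelComb (F : Fin 4 → Fin 4 → Fin 4 → Fin 4 → ℝ) : ℝ :=
  (1 / 12) * ∑ s : Fin 3 ↪ Fin 4, F (s 0) (s 0) (s 1) (s 2)
  - (1 / 24) * ∑ s : Fin 4 ↪ Fin 4, F (s 0) (s 1) (s 2) (s 3)
  - (1 / 12) * ∑ s : Fin 2 ↪ Fin 4, F (s 0) (s 0) (s 1) (s 1)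

/-- The product of the increments of `u` and `v` between `i` and `j`. -/
def incrProd (u v : Fin 4 → ℂ) (i j : Fin 4) : ℂ := (u i - u j) * (v i - v j)

/-- The unbiased estimate of `|cov(u, v)|²` from four sample points. -/
def covKernel (u v : Fin 4 → ℂ) : ℝ :=
  (1 / 12) * (incrProd u v 0 1 * starRingEnd ℂ (incrProd u v 2 3) +
    incrProd u v 0 2 * starRingEnd ℂ (incrProd u v 1 3) +
    incrProd u v 0 3 * starRingEnd ℂ (incrProd u v 1 2)).re

/-- The constants cancel, as 24/12 - 24/24 - 12/12 = 0. For independent samples the three sums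
estimate the three terms of |E uv - Eu Ev|² after expansion. The equality with the sum over pairings
is a polynomial identity, checked on real and imaginary parts after writing out all sums. -/
lemma kernelComb_one_sub_re (u v : Fin 4 → ℂ) :
    kernelComb (fun i j k l => 1 - (u i * v j * starRingEnd ℂ (u k * v l)).re) =
      covKernel u v := by
  unfold kernelComb covKernel incrProd
  rw [sum_embedding_two (fun i j => 1 - (u i * v i * starRingEnd ℂ (u j * v j)).re),
    sum_embedding_three (fun i j k => 1 - (u i * v i * starRingEnd ℂ (u j * v k)).re),
    sum_embedding_four (fun i j k l => 1 - (u i * v j * starRingEnd ℂ (u k * v l)).re)]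
  simp [Fin.sum_univ_four, Complex.mul_re, Complex.mul_im]
  ring

end KernelAlgebra

/-! ### Integral representation and pointwise bound of the kernel. -/

section Representation

variable {p : ℕ} {α : ℝ}

/-- The unimodular function `x ↦ exp(i⟨t, x⟩)`. -/
def expInner (t x : E p) : ℂ := Complex.exp (Complex.I * (⟪t, x⟫ : ℝ))

lemma norm_expInner (t x : E p) : ‖expInner t x‖ = 1 := by
  rw [expInner, mul_comm, Complex.norm_exp_ofReal_mul_I]

lemma expInner_zero (x : E p) : expInner 0 x = 1 := by simp [expInner]

lemma continuous_expInner : Continuous (fun q : E p × E p => expInner q.1 q.2) := by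
  unfold expInner
  fun_prop

lemma re_expInner_mul (t a b c d : E p) :
    (expInner t a * expInner t b * starRingEnd ℂ (expInner t c * expInner t d)).re =
      Real.cos ⟪t, a + b - c - d⟫ := by
  have : expInner t a * expInner t b * starRingEnd ℂ (expInner t c * expInner t d) =
      Complex.exp ((⟪t, a + b - c - d⟫ : ℝ) * Complex.I) := by
    unfold expInner
    rw [map_mul, ← Complex.exp_conj, ← Complex.exp_conj, ← Complex.exp_add, ← Complex.exp_add,
      ← Complex.exp_add]
    congr 1
    simp only [inner_sub_right, inner_add_right, map_mul, Complex.conj_I, Complex.conj_ofReal]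
    push_cast
    ring
  rw [this, Complex.exp_ofReal_mul_I_re]

/-- This identifies the squared L²(ρ_α) norm of an increment of exp(i⟪t, ·⟩) as 2‖a - b‖^α. -/
lemma norm_expInner_sub_sq (t a b : E p) :
    ‖expInner t a - expInner t b‖ ^ 2 = 2 * (1 - Real.cos ⟪t, a - b⟫) := by
  have h := re_expInner_mul t a 0 b 0
  have h0 : expInner t (0 : E p) = 1 := by simp [expInner]
  rw [h0, mul_one, mul_one, add_zero, sub_zero] at h
  rw [Complex.sq_norm, Complex.normSq_sub, Complex.normSq_eq_norm_sq, Complex.normSq_eq_norm_sq,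
    norm_expInner, norm_expInner, h]
  ring

/-- The integrand of the kernel in the representation by the weight `ρ_α`. -/
def covIntegrand (t : E p) (z : Fin 4 → E p × E p) : ℝ :=
  covKernel (fun a => expInner t (z a).1) (fun a => expInner t (z a).2)

lemma covIntegrand_eq_kernelComb (t : E p) (z : Fin 4 → E p × E p) :
    covIntegrand t z = kernelComb fun i j k l =>
      1 - Real.cos ⟪t, (z i).1 + (z j).2 - (z k).1 - (z l).2⟫ := by
  simp_rw [covIntegrand, ← kernelComb_one_sub_re, re_expInner_mul]

lemma kernelComb_mul_right (F : Fin 4 → Fin 4 → Fin 4 → Fin 4 → ℝ) (r : ℝ) :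
    kernelComb F * r = kernelComb fun i j k l => F i j k l * r := by
  simp only [kernelComb, ← Finset.sum_mul]
  ring

lemma integral_kernelComb {T : Type*} [MeasurableSpace T] {μ : Measure T}
    {F : T → Fin 4 → Fin 4 → Fin 4 → Fin 4 → ℝ}
    (hF : ∀ i j k l, Integrable (fun t => F t i j k l) μ) :
    ∫ t, kernelComb (F t) ∂μ = kernelComb fun i j k l => ∫ t, F t i j k l ∂μ := by
  have h3 : Integrable (fun t => (1 / 12) * ∑ s : Fin 3 ↪ Fin 4, F t (s 0) (s 0) (s 1) (s 2)) μ :=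
    (integrable_finsetSum _ fun _ _ => hF _ _ _ _).const_mul _
  have h4 : Integrable (fun t => (1 / 24) * ∑ s : Fin 4 ↪ Fin 4, F t (s 0) (s 1) (s 2) (s 3)) μ :=
    (integrable_finsetSum _ fun _ _ => hF _ _ _ _).const_mul _
  have h2 : Integrable (fun t => (1 / 12) * ∑ s : Fin 2 ↪ Fin 4, F t (s 0) (s 0) (s 1) (s 1)) μ :=
    (integrable_finsetSum _ fun _ _ => hF _ _ _ _).const_mul _
  unfold kernelComb
  rw [integral_sub (by exact h3.sub h4) h2, integral_sub h3 h4]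
  simp only [integral_const_mul]
  rw [integral_finsetSum _ fun _ _ => hF _ _ _ _, integral_finsetSum _ fun _ _ => hF _ _ _ _,
    integral_finsetSum _ fun _ _ => hF _ _ _ _]

/-- The combination is linear in the values of `F`, so the representation of ‖x‖^α can be inserted
term by term and the integral taken outside. -/
lemma kernel_eq_integral (hα0 : 0 < α) (hα2 : α < 2) (z : Fin 4 → E p × E p) :
    kernel α z = ∫ t, covIntegrand t z * rho α t := by
  simp_rw [covIntegrand_eq_kernelComb, kernelComb_mul_right]
  rw [integral_kernelComb fun i j k l => integrable_one_sub_cos_mul_rho hα0 hα2 _]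
  simp_rw [integral_one_sub_cos_mul_rho hα0 hα2]
  rfl

lemma kernel_comp_perm (σ : Equiv.Perm (Fin 4)) (z : Fin 4 → E p × E p) :
    kernel α (z ∘ σ) = kernel α z := by
  unfold kernel
  congr 1
  · congr 1
    · congr 1
      exact Equiv.sum_comp (Equiv.embeddingCongr (Equiv.refl (Fin 3)) σ)
        fun s : Fin 3 ↪ Fin 4 => ‖(z (s 0)).1 + (z (s 0)).2 - (z (s 1)).1 - (z (s 2)).2‖ ^ α
    · congr 1
      exact Equiv.sum_comp (Equiv.embeddingCongr (Equiv.refl (Fin 4)) σ)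
        fun s : Fin 4 ↪ Fin 4 => ‖(z (s 0)).1 + (z (s 1)).2 - (z (s 2)).1 - (z (s 3)).2‖ ^ α
  · congr 1
    exact Equiv.sum_comp (Equiv.embeddingCongr (Equiv.refl (Fin 2)) σ)
      fun s : Fin 2 ↪ Fin 4 => ‖(z (s 0)).1 + (z (s 0)).2 - (z (s 1)).1 - (z (s 1)).2‖ ^ α

lemma measurable_kernel : Measurable (kernel α : (Fin 4 → E p × E p) → ℝ) := by
  unfold kernel
  fun_prop

lemma norm_incrProd_le {u v : Fin 4 → ℂ} (hv : ∀ a, ‖v a‖ = 1) (i j : Fin 4) :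
    ‖incrProd u v i j‖ ≤ 2 * ‖u i - u j‖ := by
  rw [incrProd, norm_mul, mul_comm]
  refine mul_le_mul_of_nonneg_right ((norm_sub_le _ _).trans ?_) (norm_nonneg _)
  rw [hv, hv]; norm_num

/-- In each product of increments the two increments of `v` are at most 2, so every pairing costs a
factor 4, and 4/12 = 1/3. -/
lemma abs_covKernel_le {u v : Fin 4 → ℂ} (hv : ∀ a, ‖v a‖ = 1) :
    |covKernel u v| ≤ (1 / 3) * (‖u 0 - u 1‖ * ‖u 2 - u 3‖ + ‖u 0 - u 2‖ * ‖u 1 - u 3‖ +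
      ‖u 0 - u 3‖ * ‖u 1 - u 2‖) := by
  have h : ∀ i j k l, ‖incrProd u v i j * starRingEnd ℂ (incrProd u v k l)‖ ≤
      4 * (‖u i - u j‖ * ‖u k - u l‖) := by
    intro i j k l
    rw [norm_mul, RCLike.norm_conj]
    calc ‖incrProd u v i j‖ * ‖incrProd u v k l‖ ≤ (2 * ‖u i - u j‖) * (2 * ‖u k - u l‖) :=
          mul_le_mul (norm_incrProd_le hv i j) (norm_incrProd_le hv k l) (norm_nonneg _)
            (by positivity)
      _ = _ := by ring
  rw [covKernel, abs_mul, abs_of_pos (by norm_num : (0 : ℝ) < 1 / 12)]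
  have h3 := (Complex.abs_re_le_norm (incrProd u v 0 1 * starRingEnd ℂ (incrProd u v 2 3) +
    incrProd u v 0 2 * starRingEnd ℂ (incrProd u v 1 3) +
    incrProd u v 0 3 * starRingEnd ℂ (incrProd u v 1 2))).trans norm_add₃_le
  linarith [h 0 1 2 3, h 0 2 1 3, h 0 3 1 2]

/-- The Cauchy–Schwarz inequality for the increments of `exp(i⟨t, ·⟩)` in `L²(ρ_α)`. -/
lemma integrable_and_integral_norm_sub_mul_le (hα0 : 0 < α) (hα2 : α < 2) (a b c d : E p) :
    Integrable (fun t => ‖expInner t a - expInner t b‖ * ‖expInner t c - expInner t d‖ * rho α t) ∧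
    ∫ t, ‖expInner t a - expInner t b‖ * ‖expInner t c - expInner t d‖ * rho α t ≤
      2 * √(‖a - b‖ ^ α * ‖c - d‖ ^ α) := by
  have hr := rho_nonneg (p := p) hα0 hα2
  have hm : ∀ a b : E p, Measurable fun t : E p => √((1 - Real.cos ⟪t, a - b⟫) * rho α t) := by
    intro a b
    have := measurable_rho (p := p) (α := α)
    fun_prop
  have hsq : ∀ a b t : E p, √((1 - Real.cos ⟪t, a - b⟫) * rho α t) ^ 2 =
      (1 - Real.cos ⟪t, a - b⟫) * rho α t := fun a b t =>
    Real.sq_sqrt (mul_nonneg (by linarith [Real.cos_le_one ⟪t, a - b⟫]) (hr t))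
  have hL : ∀ a b : E p, MemLp (fun t : E p => √((1 - Real.cos ⟪t, a - b⟫) * rho α t)) 2 := by
    intro a b
    rw [memLp_two_iff_integrable_sq (hm a b).aestronglyMeasurable]
    simp_rw [hsq]
    exact integrable_one_sub_cos_mul_rho hα0 hα2 _
  have hnorm : ∀ a b t : E p, ‖expInner t a - expInner t b‖ = √2 * √(1 - Real.cos ⟪t, a - b⟫) := by
    intro a b t
    rw [← Real.sqrt_mul two_pos.le, ← norm_expInner_sub_sq, Real.sqrt_sq (norm_nonneg _)]
  have heq : ∀ t, ‖expInner t a - expInner t b‖ * ‖expInner t c - expInner t d‖ * rho α t =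
      2 * (√((1 - Real.cos ⟪t, a - b⟫) * rho α t) * √((1 - Real.cos ⟪t, c - d⟫) * rho α t)) := by
    intro t
    rw [hnorm, hnorm, Real.sqrt_mul' _ (hr t), Real.sqrt_mul' _ (hr t)]
    have h1 := Real.mul_self_sqrt (hr t)
    have h2 := Real.mul_self_sqrt (two_pos (α := ℝ)).le
    generalize √(1 - Real.cos ⟪t, a - b⟫) = A
    generalize √(1 - Real.cos ⟪t, c - d⟫) = B
    calc √2 * A * (√2 * B) * rho α t = (√2 * √2) * A * B * (√(rho α t) * √(rho α t)) := by
          rw [h1]; ring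
      _ = _ := by rw [h2]; ring
  simp_rw [heq]
  refine ⟨((hL a b).integrable_mul (hL c d)).const_mul 2, ?_⟩
  rw [integral_const_mul]
  refine mul_le_mul_of_nonneg_left ?_ two_pos.le
  have h := integral_mul_le_Lp_mul_Lq_of_nonneg Real.HolderConjugate.two_two
    (Eventually.of_forall fun t => Real.sqrt_nonneg ((1 - Real.cos ⟪t, a - b⟫) * rho α t))
    (Eventually.of_forall fun t => Real.sqrt_nonneg ((1 - Real.cos ⟪t, c - d⟫) * rho α t))
    (by simpa using hL a b) (by simpa using hL c d)
  simp_rw [Real.rpow_two, hsq, integral_one_sub_cos_mul_rho hα0 hα2, ← Real.sqrt_eq_rpow] at h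
  rwa [Real.sqrt_mul (Real.rpow_nonneg (norm_nonneg _) _)]

/-- Cauchy–Schwarz in L²(ρ_α) for each pairing gives this with the factor 2/3, rounded up to 1. The
square roots are the gain over estimating the norms in the kernel one by one: squaring returns α-th
powers over disjoint pairs. -/
lemma abs_kernel_le (hα0 : 0 < α) (hα2 : α < 2) (z : Fin 4 → E p × E p) :
    |kernel α z| ≤ √(‖(z 0).1 - (z 1).1‖ ^ α * ‖(z 2).1 - (z 3).1‖ ^ α) +
      √(‖(z 0).1 - (z 2).1‖ ^ α * ‖(z 1).1 - (z 3).1‖ ^ α) +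
      √(‖(z 0).1 - (z 3).1‖ ^ α * ‖(z 1).1 - (z 2).1‖ ^ α) := by
  obtain ⟨hi1, h1⟩ := integrable_and_integral_norm_sub_mul_le hα0 hα2
    (z 0).1 (z 1).1 (z 2).1 (z 3).1
  obtain ⟨hi2, h2⟩ := integrable_and_integral_norm_sub_mul_le hα0 hα2
    (z 0).1 (z 2).1 (z 1).1 (z 3).1
  obtain ⟨hi3, h3⟩ := integrable_and_integral_norm_sub_mul_le hα0 hα2
    (z 0).1 (z 3).1 (z 1).1 (z 2).1
  have hb : |kernel α z| ≤ ∫ t, ((1 / 3) *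
      (‖expInner t (z 0).1 - expInner t (z 1).1‖ * ‖expInner t (z 2).1 - expInner t (z 3).1‖ *
          rho α t +
        ‖expInner t (z 0).1 - expInner t (z 2).1‖ * ‖expInner t (z 1).1 - expInner t (z 3).1‖ *
          rho α t +
        ‖expInner t (z 0).1 - expInner t (z 3).1‖ * ‖expInner t (z 1).1 - expInner t (z 2).1‖ *
          rho α t)) := by
    rw [kernel_eq_integral hα0 hα2, ← Real.norm_eq_abs]
    refine norm_integral_le_of_norm_le (((hi1.add hi2).add hi3).const_mul _)
      (Eventually.of_forall fun t => ?_)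
    rw [Real.norm_eq_abs, abs_mul, abs_of_nonneg (rho_nonneg hα0 hα2 t)]
    refine (mul_le_mul_of_nonneg_right (abs_covKernel_le fun a => norm_expInner t (z a).2)
      (rho_nonneg hα0 hα2 t)).trans_eq ?_
    ring
  rw [integral_const_mul, integral_add (by exact hi1.add hi2) hi3, integral_add hi1 hi2] at hb
  have := Real.sqrt_nonneg (‖(z 0).1 - (z 1).1‖ ^ α * ‖(z 2).1 - (z 3).1‖ ^ α)
  have := Real.sqrt_nonneg (‖(z 0).1 - (z 2).1‖ ^ α * ‖(z 1).1 - (z 3).1‖ ^ α)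
  have := Real.sqrt_nonneg (‖(z 0).1 - (z 3).1‖ ^ α * ‖(z 1).1 - (z 2).1‖ ^ α)
  linarith

end Representation

/-! ### Square integrability and mean of the kernel. -/

section Moments

variable {p : ℕ} {α : ℝ} {ν : Measure (E p × E p)} [IsProbabilityMeasure ν]

lemma norm_sub_rpow_le (hα0 : 0 < α) (a b : E p) :
    ‖a - b‖ ^ α ≤ 2 ^ α * (‖a‖ ^ α + ‖b‖ ^ α) := by
  have hmax : ‖a - b‖ ≤ 2 * max ‖a‖ ‖b‖ := by
    linarith [norm_sub_le a b, le_max_left ‖a‖ ‖b‖, le_max_right ‖a‖ ‖b‖]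
  have ha := Real.rpow_nonneg (norm_nonneg a) α
  have hb := Real.rpow_nonneg (norm_nonneg b) α
  calc ‖a - b‖ ^ α ≤ (2 * max ‖a‖ ‖b‖) ^ α := Real.rpow_le_rpow (norm_nonneg _) hmax hα0.le
    _ = 2 ^ α * max ‖a‖ ‖b‖ ^ α :=
        Real.mul_rpow two_pos.le ((norm_nonneg a).trans (le_max_left _ _))
    _ ≤ 2 ^ α * (‖a‖ ^ α + ‖b‖ ^ α) := by
        refine mul_le_mul_of_nonneg_left ?_ (Real.rpow_nonneg two_pos.le _)
        rcases max_cases ‖a‖ ‖b‖ with ⟨h, _⟩ | ⟨h, _⟩ <;> rw [h] <;> linarith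

lemma iIndepFun_eval {S : Type*} [MeasurableSpace S] {ν : Measure S} [IsProbabilityMeasure ν]
    (m : ℕ) : iIndepFun (fun (a : Fin m) (z : Fin m → S) => z a) (Measure.pi fun _ => ν) :=
  iIndepFun_pi (X := fun _ => id) fun _ => aemeasurable_id

lemma integrable_comp_eval {S F : Type*} [MeasurableSpace S] [NormedAddCommGroup F]
    {ν : Measure S} [IsProbabilityMeasure ν] {m : ℕ} {f : S → F} (hf : Integrable f ν) (a : Fin m) :
    Integrable (fun z : Fin m → S => f (z a)) (Measure.pi fun _ => ν) :=
  (measurePreserving_eval (fun _ : Fin m => ν) a).integrable_comp_of_integrable hf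

lemma integrable_norm_sub_rpow (hα0 : 0 < α) (hν : Integrable (fun z => ‖z.1‖ ^ α) ν)
    {m : ℕ} (a b : Fin m) :
    Integrable (fun z : Fin m → E p × E p => ‖(z a).1 - (z b).1‖ ^ α) (Measure.pi fun _ => ν) := by
  refine Integrable.mono' (((integrable_comp_eval hν a).add
    (integrable_comp_eval hν b)).const_mul (2 ^ α)) ?_ (Eventually.of_forall fun z => ?_)
  · exact Measurable.aestronglyMeasurable (by fun_prop)
  · rw [Real.norm_of_nonneg (Real.rpow_nonneg (norm_nonneg _) _)]
    exact norm_sub_rpow_le hα0 _ _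

lemma indepFun_comp_pairs {m : ℕ} {S : Type*} [MeasurableSpace S] {ν : Measure S}
    [IsProbabilityMeasure ν] {a b c d : Fin m} (hac : a ≠ c) (had : a ≠ d) (hbc : b ≠ c)
    (hbd : b ≠ d) : IndepFun (fun z : Fin m → S => (z a, z b)) (fun z : Fin m → S => (z c, z d))
      (Measure.pi fun _ => ν) :=
  (iIndepFun_eval m).indepFun_prodMk_prodMk (fun a => measurable_pi_apply a) a b c d hac had hbc hbd

/-- The square is a product of functions of two disjoint pairs of sample points. These are
independent, so integrability of each factor suffices. -/
lemma memLp_sqrt_norm_sub_rpow_mul (hα0 : 0 < α) (hν : Integrable (fun z => ‖z.1‖ ^ α) ν)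
    {m : ℕ} {a b c d : Fin m} (hac : a ≠ c) (had : a ≠ d) (hbc : b ≠ c) (hbd : b ≠ d) :
    MemLp (fun z : Fin m → E p × E p =>
      √(‖(z a).1 - (z b).1‖ ^ α * ‖(z c).1 - (z d).1‖ ^ α)) 2 (Measure.pi fun _ => ν) := by
  have hm : Measurable fun z : Fin m → E p × E p =>
      √(‖(z a).1 - (z b).1‖ ^ α * ‖(z c).1 - (z d).1‖ ^ α) := by fun_prop
  rw [memLp_two_iff_integrable_sq hm.aestronglyMeasurable]
  have hsq : ∀ z : Fin m → E p × E p,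
      √(‖(z a).1 - (z b).1‖ ^ α * ‖(z c).1 - (z d).1‖ ^ α) ^ 2 =
        ‖(z a).1 - (z b).1‖ ^ α * ‖(z c).1 - (z d).1‖ ^ α := fun z =>
    Real.sq_sqrt (mul_nonneg (Real.rpow_nonneg (norm_nonneg _) _)
      (Real.rpow_nonneg (norm_nonneg _) _))
  simp_rw [hsq]
  have hf : Measurable fun x : (E p × E p) × (E p × E p) => ‖x.1.1 - x.2.1‖ ^ α := by fun_prop
  exact ((indepFun_comp_pairs (ν := ν) hac had hbc hbd).comp hf hf).integrable_mul
    (integrable_norm_sub_rpow hα0 hν a b) (integrable_norm_sub_rpow hα0 hν c d)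

/-- The kernel is square integrable under the moment condition of order `α` alone. -/
lemma memLp_kernel (hα0 : 0 < α) (hα2 : α < 2) (hν : Integrable (fun z => ‖z.1‖ ^ α) ν) :
    MemLp (kernel α) 2 (Measure.pi fun _ : Fin 4 => ν) := by
  refine MemLp.mono' (((memLp_sqrt_norm_sub_rpow_mul hα0 hν (a := (0 : Fin 4)) (b := 1) (c := 2)
    (d := 3) (by decide) (by decide) (by decide) (by decide)).add
    (memLp_sqrt_norm_sub_rpow_mul hα0 hν (a := (0 : Fin 4)) (b := 2) (c := 1)
    (d := 3) (by decide) (by decide) (by decide) (by decide))).add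
    (memLp_sqrt_norm_sub_rpow_mul hα0 hν (a := (0 : Fin 4)) (b := 3) (c := 1)
    (d := 2) (by decide) (by decide) (by decide) (by decide)))
    measurable_kernel.aestronglyMeasurable (Eventually.of_forall fun z => ?_)
  exact abs_kernel_le hα0 hα2 z

/-- Products of increments over disjoint pairs of sample points are uncorrelated, and each has
mean twice the covariance. -/
lemma integral_incrProd_mul_conj {S : Type*} [MeasurableSpace S] {ν : Measure S}
    [IsProbabilityMeasure ν] {U V : S → ℂ} (hU : Measurable U) (hV : Measurable V)
    (hU1 : ∀ z, ‖U z‖ = 1) (hV1 : ∀ z, ‖V z‖ = 1) {m : ℕ} :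
    (∀ i j : Fin m, i ≠ j → ∫ z : Fin m → S, (U (z i) - U (z j)) * (V (z i) - V (z j))
      ∂(Measure.pi fun _ => ν) = 2 * (∫ x, U x * V x ∂ν - (∫ x, U x ∂ν) * ∫ x, V x ∂ν)) := by
  intro i j hij
  have hUi : Integrable U ν := Integrable.of_bound hU.aestronglyMeasurable 1
    (Eventually.of_forall fun z => (hU1 z).le)
  have hVi : Integrable V ν := Integrable.of_bound hV.aestronglyMeasurable 1
    (Eventually.of_forall fun z => (hV1 z).le)
  have hUVi : Integrable (fun x => U x * V x) ν := Integrable.of_bound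
    (hU.mul hV).aestronglyMeasurable 1 (Eventually.of_forall fun z => by
      rw [norm_mul, hU1, hV1, one_mul])
  have hdiag : ∀ a : Fin m, ∫ z : Fin m → S, U (z a) * V (z a) ∂(Measure.pi fun _ => ν) =
      ∫ x, U x * V x ∂ν := fun a =>
    integral_comp_eval (μ := fun _ : Fin m => ν) (i := a) (f := fun x => U x * V x) hUVi.1
  have hoff : ∀ a b : Fin m, a ≠ b → ∫ z : Fin m → S, U (z a) * V (z b) ∂(Measure.pi fun _ => ν) =
      (∫ x, U x ∂ν) * ∫ x, V x ∂ν := by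
    intro a b hab
    have hI : IndepFun (fun z : Fin m → S => z a) (fun z : Fin m → S => z b)
        (Measure.pi fun _ => ν) := (iIndepFun_eval m).indepFun hab
    rw [hI.integral_fun_comp_mul_comp (measurable_pi_apply a).aemeasurable
      (measurable_pi_apply b).aemeasurable hU.aestronglyMeasurable hV.aestronglyMeasurable]
    rw [integral_comp_eval hU.aestronglyMeasurable, integral_comp_eval hV.aestronglyMeasurable]
  have hint : ∀ a b : Fin m, Integrable (fun z : Fin m → S => U (z a) * V (z b))
      (Measure.pi fun _ => ν) := by
    intro a b
    have h1 : Measurable fun z : Fin m → S => U (z a) := hU.comp (measurable_pi_apply a)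
    have h2 : Measurable fun z : Fin m → S => V (z b) := hV.comp (measurable_pi_apply b)
    exact Integrable.of_bound (h1.mul h2).aestronglyMeasurable 1
      (Eventually.of_forall fun z => by rw [norm_mul, hU1, hV1, one_mul])
  have hexp : ∀ z : Fin m → S, (U (z i) - U (z j)) * (V (z i) - V (z j)) =
      (U (z i) * V (z i) - U (z i) * V (z j)) - (U (z j) * V (z i) - U (z j) * V (z j)) := by
    intro z; ring
  simp_rw [hexp]
  rw [integral_sub (by exact (hint i i).sub (hint i j)) (by exact (hint j i).sub (hint j j)),
    integral_sub (hint i i) (hint i j), integral_sub (hint j i) (hint j j), hdiag, hdiag,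
    hoff i j hij, hoff j i hij.symm]
  ring

/-- Each pairing contributes (2κ) times its conjugate, that is 4|κ|², because the two pairs are
independent; the three pairings cancel the factor 1/12. -/
lemma integral_covKernel {S : Type*} [MeasurableSpace S] {ν : Measure S}
    [IsProbabilityMeasure ν] {U V : S → ℂ} (hU : Measurable U) (hV : Measurable V)
    (hU1 : ∀ z, ‖U z‖ = 1) (hV1 : ∀ z, ‖V z‖ = 1) :
    ∫ z : Fin 4 → S, covKernel (fun a => U (z a)) (fun a => V (z a)) ∂(Measure.pi fun _ => ν) =
      ‖∫ x, U x * V x ∂ν - (∫ x, U x ∂ν) * ∫ x, V x ∂ν‖ ^ 2 := by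
  set κ : ℂ := ∫ x, U x * V x ∂ν - (∫ x, U x ∂ν) * ∫ x, V x ∂ν
  let D : S × S → ℂ := fun x => (U x.1 - U x.2) * (V x.1 - V x.2)
  have hD : Measurable D := by fun_prop
  have hD4 : ∀ x, ‖D x‖ ≤ 4 := fun x => by
    have h1 : ‖U x.1 - U x.2‖ ≤ 2 := (norm_sub_le _ _).trans (by rw [hU1, hU1]; norm_num)
    have h2 : ‖V x.1 - V x.2‖ ≤ 2 := (norm_sub_le _ _).trans (by rw [hV1, hV1]; norm_num)
    rw [norm_mul]
    nlinarith [norm_nonneg (U x.1 - U x.2), norm_nonneg (V x.1 - V x.2)]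
  have hmean : ∀ i j : Fin 4, i ≠ j → ∫ z : Fin 4 → S, D (z i, z j) ∂(Measure.pi fun _ => ν) =
      2 * κ := integral_incrProd_mul_conj hU hV hU1 hV1
  have hpair : ∀ i j k l : Fin 4, i ≠ j → k ≠ l → i ≠ k → i ≠ l → j ≠ k → j ≠ l →
      ∫ z : Fin 4 → S, D (z i, z j) * starRingEnd ℂ (D (z k, z l)) ∂(Measure.pi fun _ => ν) =
        ((4 * ‖κ‖ ^ 2 : ℝ) : ℂ) := by
    intro i j k l hij hkl hik hil hjk hjl
    have hmij : Measurable fun z : Fin 4 → S => (z i, z j) := by fun_prop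
    have hmkl : Measurable fun z : Fin 4 → S => (z k, z l) := by fun_prop
    have hDc : Measurable fun x => starRingEnd ℂ (D x) :=
      Complex.continuous_conj.measurable.comp hD
    rw [(indepFun_comp_pairs (ν := ν) hik hil hjk hjl).integral_fun_comp_mul_comp
      hmij.aemeasurable hmkl.aemeasurable hD.aestronglyMeasurable hDc.aestronglyMeasurable,
      integral_conj, hmean i j hij, hmean k l hkl, Complex.mul_conj, Complex.normSq_eq_norm_sq]
    congr 1
    rw [norm_mul, Complex.norm_ofNat]
    ring
  have hint : ∀ i j k l : Fin 4, Integrable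
      (fun z : Fin 4 → S => D (z i, z j) * starRingEnd ℂ (D (z k, z l)))
      (Measure.pi fun _ => ν) := by
    intro i j k l
    have h1 : Measurable fun z : Fin 4 → S => D (z i, z j) := hD.comp (by fun_prop)
    have h2 : Measurable fun z : Fin 4 → S => starRingEnd ℂ (D (z k, z l)) :=
      Complex.continuous_conj.measurable.comp (hD.comp (by fun_prop))
    refine Integrable.of_bound (h1.mul h2).aestronglyMeasurable 16 (Eventually.of_forall fun z => ?_)
    rw [norm_mul, RCLike.norm_conj]
    nlinarith [hD4 (z i, z j), hD4 (z k, z l), norm_nonneg (D (z i, z j)),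
      norm_nonneg (D (z k, z l))]
  have hsum := ((hint 0 1 2 3).add (hint 0 2 1 3)).add (hint 0 3 1 2)
  have hre : ∫ z : Fin 4 → S, (D (z 0, z 1) * starRingEnd ℂ (D (z 2, z 3)) +
      D (z 0, z 2) * starRingEnd ℂ (D (z 1, z 3)) +
      D (z 0, z 3) * starRingEnd ℂ (D (z 1, z 2))).re ∂(Measure.pi fun _ => ν) =
      12 * ‖κ‖ ^ 2 := by
    have h := integral_re hsum
    refine Eq.trans h ?_
    simp only [Pi.add_apply]
    rw [integral_add (by exact (hint 0 1 2 3).add (hint 0 2 1 3)) (hint 0 3 1 2),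
      integral_add (hint 0 1 2 3) (hint 0 2 1 3),
      hpair 0 1 2 3 (by decide) (by decide) (by decide) (by decide) (by decide) (by decide),
      hpair 0 2 1 3 (by decide) (by decide) (by decide) (by decide) (by decide) (by decide),
      hpair 0 3 1 2 (by decide) (by decide) (by decide) (by decide) (by decide) (by decide),
      ← Complex.ofReal_add, ← Complex.ofReal_add, RCLike.re_eq_complex_re, Complex.ofReal_re]
    ring
  simp only [covKernel, incrProd]
  rw [integral_const_mul]
  refine (congrArg _ hre).trans ?_
  ring

lemma measurable_covIntegrand : Measurable fun q : (Fin 4 → E p × E p) × E p =>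
    covIntegrand q.2 q.1 := by
  have h : ∀ i j k l : Fin 4, Measurable fun q : (Fin 4 → E p × E p) × E p =>
      1 - Real.cos ⟪q.2, (q.1 i).1 + (q.1 j).2 - (q.1 k).1 - (q.1 l).2⟫ := by
    intro i j k l
    fun_prop
  simp_rw [covIntegrand_eq_kernelComb, kernelComb]
  refine Measurable.sub (Measurable.sub ?_ ?_) ?_ <;>
    exact (Finset.measurable_fun_sum _ fun s _ => h _ _ _ _).const_mul _

/-- Integrating over t first leaves ‖x_i - x_j‖^α, which is integrable. These functions dominate the
integrand when Fubini is applied to the kernel. -/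
lemma integrable_one_sub_cos_sub_mul_rho_prod (hα0 : 0 < α) (hα2 : α < 2)
    (hν : Integrable (fun z => ‖z.1‖ ^ α) ν) (i j : Fin 4) :
    Integrable (fun q : (Fin 4 → E p × E p) × E p =>
      (1 - Real.cos ⟪q.2, (q.1 i).1 - (q.1 j).1⟫) * rho α q.2)
      ((Measure.pi fun _ => ν).prod volume) := by
  have hm : Measurable fun q : (Fin 4 → E p × E p) × E p =>
      (1 - Real.cos ⟪q.2, (q.1 i).1 - (q.1 j).1⟫) * rho α q.2 := by
    have hcos : Measurable fun q : (Fin 4 → E p × E p) × E p =>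
        1 - Real.cos ⟪q.2, (q.1 i).1 - (q.1 j).1⟫ := by fun_prop
    exact hcos.mul (measurable_rho.comp measurable_snd)
  have hnorm : ∀ z : Fin 4 → E p × E p,
      ∫ t, ‖(1 - Real.cos ⟪t, (z i).1 - (z j).1⟫) * rho α t‖ = ‖(z i).1 - (z j).1‖ ^ α := by
    intro z
    rw [← integral_one_sub_cos_mul_rho hα0 hα2]
    refine integral_congr_ae (Eventually.of_forall fun t => ?_)
    exact Real.norm_of_nonneg (mul_nonneg
      (by linarith [Real.cos_le_one ⟪t, (z i).1 - (z j).1⟫]) (rho_nonneg hα0 hα2 t))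
  have h1 : ∀ᵐ z ∂(Measure.pi fun _ : Fin 4 => ν), Integrable fun t : E p =>
      (1 - Real.cos ⟪t, (z i).1 - (z j).1⟫) * rho α t :=
    Eventually.of_forall fun z => integrable_one_sub_cos_mul_rho hα0 hα2 ((z i).1 - (z j).1)
  have h2 : Integrable (fun z : Fin 4 → E p × E p =>
      ∫ t, ‖(1 - Real.cos ⟪t, (z i).1 - (z j).1⟫) * rho α t‖) (Measure.pi fun _ => ν) := by
    simp_rw [hnorm]
    exact integrable_norm_sub_rpow hα0 hν i j
  exact (integrable_prod_iff hm.aestronglyMeasurable).2 ⟨h1, h2⟩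

/-- Fubini needs only absolute integrability, so 2xy ≤ x² + y² is enough here in place of
Cauchy–Schwarz. -/
lemma norm_expInner_sub_mul_le (t a b c d : E p) :
    ‖expInner t a - expInner t b‖ * ‖expInner t c - expInner t d‖ ≤
      (1 - Real.cos ⟪t, a - b⟫) + (1 - Real.cos ⟪t, c - d⟫) := by
  nlinarith [norm_expInner_sub_sq t a b, norm_expInner_sub_sq t c d,
    sq_nonneg (‖expInner t a - expInner t b‖ - ‖expInner t c - expInner t d‖)]

lemma abs_covIntegrand_le (t : E p) (z : Fin 4 → E p × E p) :
    |covIntegrand t z| ≤ (1 / 3) *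
      ((1 - Real.cos ⟪t, (z 0).1 - (z 1).1⟫) + (1 - Real.cos ⟪t, (z 2).1 - (z 3).1⟫) +
      ((1 - Real.cos ⟪t, (z 0).1 - (z 2).1⟫) + (1 - Real.cos ⟪t, (z 1).1 - (z 3).1⟫)) +
      ((1 - Real.cos ⟪t, (z 0).1 - (z 3).1⟫) + (1 - Real.cos ⟪t, (z 1).1 - (z 2).1⟫))) := by
  have hb := abs_covKernel_le (u := fun a => expInner t (z a).1)
    (fun a => norm_expInner t (z a).2)
  unfold covIntegrand
  linarith [norm_expInner_sub_mul_le t (z 0).1 (z 1).1 (z 2).1 (z 3).1,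
    norm_expInner_sub_mul_le t (z 0).1 (z 2).1 (z 1).1 (z 3).1,
    norm_expInner_sub_mul_le t (z 0).1 (z 3).1 (z 1).1 (z 2).1]

lemma integrable_covIntegrand_mul_rho_prod (hα0 : 0 < α) (hα2 : α < 2)
    (hν : Integrable (fun z => ‖z.1‖ ^ α) ν) :
    Integrable (fun q : (Fin 4 → E p × E p) × E p => covIntegrand q.2 q.1 * rho α q.2)
      ((Measure.pi fun _ => ν).prod volume) := by
  have hpair := fun i j => integrable_one_sub_cos_sub_mul_rho_prod hα0 hα2 hν i j
  have hρm : Measurable fun q : (Fin 4 → E p × E p) × E p => rho α q.2 :=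
    measurable_rho.comp measurable_snd
  refine Integrable.mono' (((((hpair 0 1).add (hpair 2 3)).add ((hpair 0 2).add (hpair 1 3))).add
    ((hpair 0 3).add (hpair 1 2))).const_mul (1 / 3))
    (measurable_covIntegrand.mul hρm).aestronglyMeasurable (Eventually.of_forall fun q => ?_)
  have hr := rho_nonneg hα0 hα2 q.2
  simp only [Pi.add_apply]
  rw [Real.norm_eq_abs, abs_mul, abs_of_nonneg hr]
  refine (mul_le_mul_of_nonneg_right (abs_covIntegrand_le q.2 q.1) hr).trans_eq ?_
  ring

/-- The kernel is an unbiased estimate: its mean is the weighted integral of the squared modulus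
of the covariance of `exp(i⟨t, x⟩)` and `exp(i⟨t, y⟩)`. -/
lemma integral_kernel (hα0 : 0 < α) (hα2 : α < 2) (hν : Integrable (fun z => ‖z.1‖ ^ α) ν) :
    ∫ z, kernel α z ∂(Measure.pi fun _ : Fin 4 => ν) =
      ∫ t, ‖∫ x, expInner t x.1 * expInner t x.2 ∂ν -
        (∫ x, expInner t x.1 ∂ν) * ∫ x, expInner t x.2 ∂ν‖ ^ 2 * rho α t := by
  simp_rw [kernel_eq_integral hα0 hα2]
  rw [integral_integral_swap (f := fun (z : Fin 4 → E p × E p) (t : E p) =>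
    covIntegrand t z * rho α t) (integrable_covIntegrand_mul_rho_prod hα0 hα2 hν)]
  refine integral_congr_ae (Eventually.of_forall fun t => ?_)
  simp only
  rw [integral_mul_const]
  congr 1
  have he : Measurable (expInner t) :=
    (continuous_expInner.comp (by fun_prop : Continuous fun x => (t, x))).measurable
  exact integral_covKernel (U := fun x : E p × E p => expInner t x.1)
    (V := fun x : E p × E p => expInner t x.2) (he.comp measurable_fst)
    (he.comp measurable_snd) (fun z => norm_expInner _ _) (fun z => norm_expInner _ _)

end Moments

/-! ### Identification of the projection and the mean with `kOne` and `siCov`. -/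

section Estimator

variable {p : ℕ} {α : ℝ}

lemma measurePreserving_vec_three {S : Type*} [MeasurableSpace S] (ν : Measure S)
    [IsProbabilityMeasure ν] :
    MeasurePreserving (fun w : S × S × S => ![w.1, w.2.1, w.2.2]) (ν.prod (ν.prod ν))
      (Measure.pi fun _ : Fin 3 => ν) := by
  have h2 : MeasurePreserving (fun w : S × S => ![w.1, w.2]) (ν.prod ν)
      (Measure.pi fun _ : Fin 2 => ν) := by
    convert! (measurePreserving_piFinTwo (fun _ : Fin 2 => ν)).symm using 1
  exact (measurePreserving_finCons ν).comp ((MeasurePreserving.id ν).prod h2)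

lemma firstProj_kernel (ν : Measure (E p × E p)) [IsProbabilityMeasure ν] :
    firstProj ν (kernel α) = kOne α ν := by
  funext z
  have h := measurePreserving_vec_three ν
  have hm : Measurable fun w : Fin 3 → E p × E p => kernel α (Fin.cons z w) :=
    measurable_kernel.comp (measurable_finCons.comp measurable_prodMk_left)
  exact (integral_comp_of_map_eq h.measurable.aemeasurable h.map_eq hm.aestronglyMeasurable).symm

lemma jointCF_eq {Ω : Type*} [MeasurableSpace Ω] {P : Measure Ω} {X Y : Ω → E p}
    (hX : AEMeasurable X P) (hY : AEMeasurable Y P) (s t : E p) :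
    jointCF P X Y s t = ∫ x, expInner s x.1 * expInner t x.2 ∂(P.map fun ω => (X ω, Y ω)) := by
  have he : ∀ t : E p, Continuous (expInner t) := fun t =>
    continuous_expInner.comp (by fun_prop : Continuous fun x => (t, x))
  have hm : Measurable fun x : E p × E p => expInner s x.1 * expInner t x.2 :=
    ((he s).measurable.comp measurable_fst).mul ((he t).measurable.comp measurable_snd)
  rw [integral_map (hX.prodMk hY) hm.aestronglyMeasurable]
  simp only [jointCF, expInner, Complex.exp_add]

lemma siCov_eq_integral_kernel (hα0 : 0 < α) (hα2 : α < 2) {Ω : Type*} [MeasurableSpace Ω]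
    {P : Measure Ω} [IsProbabilityMeasure P] {X Y : Ω → E p}
    (hX : AEMeasurable X P) (hY : AEMeasurable Y P) (hXα : Integrable (fun ω => ‖X ω‖ ^ α) P) :
    siCov P α X Y =
      ∫ z, kernel α z ∂(Measure.pi fun _ : Fin 4 => P.map fun ω => (X ω, Y ω)) := by
  have hXY : AEMeasurable (fun ω => (X ω, Y ω)) P := hX.prodMk hY
  have := Measure.isProbabilityMeasure_map hXY
  have hν : Integrable (fun z : E p × E p => ‖z.1‖ ^ α) (P.map fun ω => (X ω, Y ω)) :=
    (integrable_map_measure (Measurable.aestronglyMeasurable (by fun_prop)) hXY).2 hXα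
  rw [integral_kernel hα0 hα2 hν, siCov]
  simp only [jointCF_eq hX hY, expInner_zero, mul_one, one_mul]

end Estimator

end SubIndep

end

/-! ### The central limit theorem for the estimator. -/

theorem theorem5p2 {p : ℕ} {α : ℝ} (hα0 : 0 < α) (hα2 : α < 2)
    {Ω' : Type*} [MeasurableSpace Ω'] {P' : Measure Ω'} [IsProbabilityMeasure P']
    {X Y : Ω' → SubIndep.E p} (hX : AEMeasurable X P') (hY : AEMeasurable Y P')
    (hXα : Integrable (fun ω => ‖X ω‖ ^ α) P') (hYα : Integrable (fun ω => ‖Y ω‖ ^ α) P')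
    {Ω : Type*} [MeasurableSpace Ω] {P : Measure Ω} [IsProbabilityMeasure P]
    {Xs Ys : ℕ → Ω → SubIndep.E p}
    (hindep : iIndepFun (fun i ω => (Xs i ω, Ys i ω)) P)
    (hident : ∀ i, IdentDistrib (fun ω => (Xs i ω, Ys i ω)) (fun ω => (X ω, Y ω)) P P')
    {K₁ : Ω' → ℝ}
    (hK₁ : K₁ = fun ω => SubIndep.kOne α (P'.map fun ω' => (X ω', Y ω')) (X ω, Y ω))
    (hvar_pos : 0 < evariance K₁ P') (hvar_fin : evariance K₁ P' < ⊤) :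
    TendstoInDistribution
      (fun (n : ℕ) (ω : Ω) =>
        Real.sqrt n *
          (SubIndep.siCovEst α n (fun i => (Xs i ω, Ys i ω)) - SubIndep.siCov P' α X Y))
      atTop (id : ℝ → ℝ) (fun _ => P) (gaussianReal 0 (16 * variance K₁ P').toNNReal) := by
  have hXY : AEMeasurable (fun ω => (X ω, Y ω)) P' := hX.prodMk hY
  set ν := P'.map fun ω => (X ω, Y ω) with hν
  have : IsProbabilityMeasure ν := Measure.isProbabilityMeasure_map hXY
  have hνα : Integrable (fun z : SubIndep.E p × SubIndep.E p => ‖z.1‖ ^ α) ν :=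
    (integrable_map_measure (Measurable.aestronglyMeasurable (by fun_prop)) hXY).2 hXα
  have hkm : Measurable (SubIndep.kernel α : (Fin 4 → SubIndep.E p × SubIndep.E p) → ℝ) :=
    SubIndep.measurable_kernel
  have hgm : Measurable (SubIndep.kOne α ν) := by
    rw [← SubIndep.firstProj_kernel]
    exact SubIndep.measurable_firstProj hkm
  have hK₁' : K₁ = SubIndep.kOne α ν ∘ fun ω => (X ω, Y ω) := hK₁
  -- For a measurable function on a probability space, finite extended variance is the same as
  -- membership in L².
  have hKL : MemLp K₁ 2 P' := by
    refine (evariance_lt_top_iff_memLp ?_).1 hvar_fin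
    rw [hK₁']
    exact (hgm.comp_aemeasurable hXY).aestronglyMeasurable
  have hgL : MemLp (SubIndep.firstProj ν (SubIndep.kernel α)) 2 ν := by
    rw [SubIndep.firstProj_kernel]
    exact (memLp_map_measure_iff hgm.aestronglyMeasurable hXY).2 (hK₁' ▸ hKL)
  have hvar : Var[SubIndep.firstProj ν (SubIndep.kernel α); ν] = Var[K₁; P'] := by
    rw [SubIndep.firstProj_kernel, hK₁']
    exact variance_map hgm.aemeasurable hXY
  -- The order `m + 2` is four for `m = 2`, and (2 + 2)² is the factor 16 in the variance.
  have h := SubIndep.tendstoInDistribution_uStat (m := 2) (P := P) (ν := ν)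
    (fun i => (hident i).aemeasurable_fst) (fun i => (hident i).map_eq) hindep hkm
    SubIndep.kernel_comp_perm (SubIndep.memLp_kernel hα0 hα2 hνα) hgL
  rw [hvar, ← SubIndep.siCov_eq_integral_kernel hα0 hα2 hX hY hXα] at h
  norm_num at h
  -- `siCovEst` and `uStat` agree by unfolding, both being sums over strictly increasing tuples.
  exact h
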